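/- For permutations $\sigma$ of length $k$ and $\pi$ of length $n$, say that $\pi$ contains $\sigma$ if $\pi$ has a (not necessarily contiguous) subsequence of length $k$ in the same relative order as $\sigma$. A permutation class is a set $\mathcal{C}$ of permutations such that every permutation contained in a member of $\mathcal{C}$ is itself in $\mathcal{C}$; it is proper if it omits at least one permutation. The generating function of a class $\mathcal{D}$ is $\sum_{n\ge 1}|\mathcal{D}_n|x^n$, where $\mathcal{D}_n$ is the set of permutations of length $n$ in $\mathcal{D}$. Theorem. For every proper permutation class $\mathcal{C}$ there is a permutation class $\mathcal{D}$ with $\mathcal{C}\subseteq\mathcal{D}$ whose generating function is rational, that is, equal to $p(x)/q(x)$ for some polynomials $p,q\in\mathbb{Q}[x]$ with $q(0)\neq 0$. -/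

import Mathlib

/-- A permutation of arbitrary finite length: a length `n` together with a bijection of
`{0, …, n - 1}`. The empty permutation is the one with `n = 0`. -/
abbrev Permutation : Type := Σ n : ℕ, Equiv.Perm (Fin n)

/-- The permutation `σ` is contained in the permutation `π`: some subsequence of `π`, read at
increasing positions `f 0 < f 1 < …`, is in the same relative order as `σ`. -/
def Permutation.IsContainedIn (σ π : Permutation) : Prop :=
  ∃ f : Fin σ.1 ↪o Fin π.1, ∀ i j : Fin σ.1, σ.2 i < σ.2 j ↔ π.2 (f i) < π.2 (f j)

/-- A permutation class: a set of permutations closed downwards under containment. -/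
def IsPermutationClass (C : Set Permutation) : Prop :=
  ∀ σ π : Permutation, π ∈ C → σ.IsContainedIn π → σ ∈ C

/-- A permutation class is proper if it omits at least one permutation. -/
def IsProperPermutationClass (C : Set Permutation) : Prop :=
  IsPermutationClass C ∧ ∃ π : Permutation, π ∉ C

/-- The set `X_n` of the permutations of length `n` in `X`. -/
def permutationsOfLength (X : Set Permutation) (n : ℕ) : Set (Equiv.Perm (Fin n)) :=
  {π | (⟨n, π⟩ : Permutation) ∈ X}

/-- The generating function `∑_{n ≥ 1} |X_n| x ^ n` of a set of permutations
(the empty permutation is not counted). -/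
noncomputable def generatingFunction (X : Set Permutation) : PowerSeries ℚ :=
  PowerSeries.mk fun n => if n = 0 then 0 else ((permutationsOfLength X n).ncard : ℚ)

/-- A formal power series is rational if it is a quotient `p / q` of two polynomials, where `q` is
invertible as a power series. -/
def IsRationalSeries (f : PowerSeries ℚ) : Prop :=
  ∃ p q : Polynomial ℚ, q.coeff 0 ≠ 0 ∧ f * (q : PowerSeries ℚ) = (p : PowerSeries ℚ)

/-!
# Every proper permutation class lies in a class with a rational generating function

The containing class is made of a class `B` with a rational generating function, large enough that
its counting sequence absorbs that of `C`.

A proper class `C` has at most `K ^ n` members of length `n`, by the Marcus–Tardos theorem and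
Klazar's argument (`exists_ncard_not_isContainedIn_le`): a set of cells of a grid avoiding a
pattern has linearly many cells, and contracting blocks bounds the number of such sets recursively.

Let `B = bandClass k` be the class of the permutations `π` with `|π i - i| ≤ k` for all `i`. It is
closed under direct sums, and its counting series is rational by the transfer matrix method
(`isRationalSeries_bandPermutations`). Its members are equally those in which each entry is in at
most `k` inversions with entries to its right, and in at most `k` with entries to its left. Call an
indecomposable member *saturated* if every entry lies weakly to the right of and below one for which
the first bound is attained, and weakly to the left of and above one for which the second is
(`IsSaturated`). As inversion graphs of indecomposable permutations are connected, any further entry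
would exceed one of the bounds, so no indecomposable member of `B` properly contains a saturated one
(`IsSaturated.eq_of_isContainedIn`). On the other hand, for large `k` there are at least `K ^ n`
saturated permutations of each large length `n` (`exists_pow_le_ncard_isSaturated`): it suffices
that sparse pairs of entries at distance `k` are swapped, while the entries in between are permuted
arbitrarily within short intervals.

Hence for each large `n` one can remove from the indecomposable members of `B` as many saturated
ones outside `C` as `C` contributes indecomposables outside `B`. The permutations whose
indecomposable patterns belong to the resulting set form a class `D ⊇ C` with, for large `n`,
exactly as many indecomposables of length `n` as `B`. The counting series of a sum-closed class is
`1 / (1 - I)`, where `I` is that of its indecomposables (`countingSeries_mul_one_sub`). As the two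
series `I` differ by a polynomial, the rationality of the series of `B` passes to that of `D`.
-/


/-! ### The Marcus–Tardos bound -/

/-- The set `M` of cells of the grid `ℕ × ℕ` contains the pattern `P`: some rows `g 0 < g 1 < …` and
columns `f 0 < f 1 < …` can be chosen such that `M` has all the cells of the matrix of `P`. -/
def PatternOccurs {k : ℕ} (P : Equiv.Perm (Fin k)) (M : Finset (ℕ × ℕ)) : Prop :=
  ∃ f g : Fin k → ℕ, StrictMono f ∧ StrictMono g ∧ ∀ i, (f i, g (P i)) ∈ M

namespace PatternOccurs

variable {k : ℕ} {P : Equiv.Perm (Fin k)} {M : Finset (ℕ × ℕ)}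

theorem of_points (p : Fin k → ℕ × ℕ) (hp : ∀ i, p i ∈ M) (h1 : StrictMono fun i => (p i).1)
    (h2 : StrictMono fun j => (p (P.symm j)).2) : PatternOccurs P M :=
  ⟨_, _, h1, h2, fun i => by simpa using hp i⟩

theorem of_swap (h : PatternOccurs P.symm (M.image Prod.swap)) : PatternOccurs P M := by
  obtain ⟨f, g, hf, hg, h⟩ := h
  refine ⟨g, f, hg, hf, fun i => ?_⟩
  have := h (P i)
  simpa using this

end PatternOccurs

/-- The `b × b` block of the grid containing the cell `p`. -/
def gridBlock (b : ℕ) (p : ℕ × ℕ) : ℕ × ℕ := (p.1 / b, p.2 / b)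

/-- The columns in which `M` has a cell lying in the block `q`. -/
def blockColumns (b : ℕ) (M : Finset (ℕ × ℕ)) (q : ℕ × ℕ) : Finset ℕ :=
  (M.filter fun p => gridBlock b p = q).image Prod.fst

/-- The rows in which `M` has a cell lying in the block `q`. -/
def blockRows (b : ℕ) (M : Finset (ℕ × ℕ)) (q : ℕ × ℕ) : Finset ℕ :=
  (M.filter fun p => gridBlock b p = q).image Prod.snd

theorem mem_blockColumns {b : ℕ} {M : Finset (ℕ × ℕ)} {q : ℕ × ℕ} {x : ℕ} :
    x ∈ blockColumns b M q ↔ ∃ p ∈ M, gridBlock b p = q ∧ p.1 = x := by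
  simp only [blockColumns, Finset.mem_image, Finset.mem_filter, and_assoc]

theorem mem_blockRows {b : ℕ} {M : Finset (ℕ × ℕ)} {q : ℕ × ℕ} {y : ℕ} :
    y ∈ blockRows b M q ↔ ∃ p ∈ M, gridBlock b p = q ∧ p.2 = y := by
  simp only [blockRows, Finset.mem_image, Finset.mem_filter, and_assoc]

theorem blockRows_eq (b : ℕ) (M : Finset (ℕ × ℕ)) (q : ℕ × ℕ) :
    blockRows b M q = blockColumns b (M.image Prod.swap) q.swap := by
  ext y
  rw [mem_blockRows, mem_blockColumns, Finset.exists_mem_image]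
  refine exists_congr fun p => and_congr_right fun _ => and_congr_left fun _ => ?_
  exact Prod.swap_injective.eq_iff (a := gridBlock b p).symm

theorem div_eq_mem_Ico {b x a : ℕ} (hb : 0 < b) (h : x / b = a) :
    x ∈ Finset.Ico (a * b) (a * b + b) := by
  rw [Nat.div_eq_iff hb] at h
  rw [Finset.mem_Ico]; omega

theorem blockColumns_subset {b : ℕ} (hb : 0 < b) (M : Finset (ℕ × ℕ)) (q : ℕ × ℕ) :
    blockColumns b M q ⊆ Finset.Ico (q.1 * b) (q.1 * b + b) := by
  intro x hx
  obtain ⟨p, _, h, rfl⟩ := mem_blockColumns.1 hx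
  exact div_eq_mem_Ico hb (congrArg Prod.fst h)

theorem card_block_le {b : ℕ} (hb : 0 < b) (M : Finset (ℕ × ℕ)) (q : ℕ × ℕ) :
    (M.filter fun p => gridBlock b p = q).card ≤ b ^ 2 := by
  have : (M.filter fun p => gridBlock b p = q) ⊆
      Finset.Ico (q.1 * b) (q.1 * b + b) ×ˢ Finset.Ico (q.2 * b) (q.2 * b + b) := by
    intro p hp
    rw [Finset.mem_filter] at hp
    exact Finset.mem_product.2 ⟨div_eq_mem_Ico hb (congrArg Prod.fst hp.2),
      div_eq_mem_Ico hb (congrArg Prod.snd hp.2)⟩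
  refine (Finset.card_le_card this).trans ?_
  simp [sq]

/-- A set avoiding a pattern stays so after contracting each block to a single cell. -/
theorem PatternOccurs.of_contraction {k b : ℕ} {P : Equiv.Perm (Fin k)} {M : Finset (ℕ × ℕ)}
    (h : PatternOccurs P (M.image (gridBlock b))) : PatternOccurs P M := by
  obtain ⟨f, g, hf, hg, h⟩ := h
  simp only [Finset.mem_image] at h
  choose p hp hpq using h
  refine .of_points p hp (fun i j hij => ?_) (fun i j hij => ?_)
  · have := hf hij
    have hi := congrArg Prod.fst (hpq i)
    have hj := congrArg Prod.fst (hpq j)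
    simp only at hi hj
    rw [← hi, ← hj] at this
    exact Nat.lt_of_div_lt_div this
  · have := hg hij
    have hi := congrArg Prod.snd (hpq (P.symm i))
    have hj := congrArg Prod.snd (hpq (P.symm j))
    simp only [Equiv.apply_symm_apply] at hi hj
    rw [← hi, ← hj] at this
    exact Nat.lt_of_div_lt_div this

/-- Few blocks in one column of blocks can meet `k` or more columns: among too many of them, `k`
share `k` columns, and there every pattern of length `k` occurs. -/
theorem card_wide_le {k b : ℕ} {P : Equiv.Perm (Fin k)} {M : Finset (ℕ × ℕ)} (hb : 0 < b)
    (h : ¬ PatternOccurs P M) (a : ℕ) (R : Finset ℕ)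
    (hR : ∀ r ∈ R, k ≤ (blockColumns b M (a, r)).card) : R.card ≤ 2 ^ b * k := by
  by_contra! hlt
  have hcard : (Finset.Ico (a * b) (a * b + b)).powerset.card = 2 ^ b := by simp
  rw [← hcard] at hlt
  obtain ⟨S, -, hS⟩ := Finset.exists_lt_card_fiber_of_mul_lt_card_of_maps_to
    (f := fun r => blockColumns b M (a, r))
    (fun r _ => Finset.mem_powerset.2 (blockColumns_subset hb M (a, r))) hlt
  obtain ⟨R', hR', hR'k⟩ := Finset.exists_subset_card_eq hS.le
  have hmem : ∀ r ∈ R', r ∈ R ∧ blockColumns b M (a, r) = S := fun r hr =>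
    Finset.mem_filter.1 (hR' hr)
  have hSk : k ≤ S.card := by
    obtain ⟨r, hr⟩ := Finset.card_pos.1 (Nat.zero_le _ |>.trans_lt hS)
    obtain ⟨hr1, rfl⟩ := Finset.mem_filter.1 hr
    exact hR r hr1
  obtain ⟨S', hS', hS'k⟩ := Finset.exists_subset_card_eq hSk
  have key : ∀ i : Fin k, ∃ p ∈ M, p.1 = S'.orderEmbOfFin hS'k i ∧
      p.2 / b = R'.orderEmbOfFin hR'k (P i) := by
    intro i
    have h1 := (hmem _ (R'.orderEmbOfFin_mem hR'k (P i))).2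
    have h2 := hS' (S'.orderEmbOfFin_mem hS'k i)
    rw [← h1] at h2
    obtain ⟨p, hp, hq, hx⟩ := mem_blockColumns.1 h2
    exact ⟨p, hp, hx, congrArg Prod.snd hq⟩
  choose p hp hp1 hp2 using key
  refine h (.of_points p hp (fun i j hij => ?_) (fun i j hij => ?_))
  · simp only [hp1]
    exact (S'.orderEmbOfFin hS'k).strictMono hij
  · have := (R'.orderEmbOfFin hR'k).strictMono hij
    have hi := hp2 (P.symm i)
    have hj := hp2 (P.symm j)
    simp only [Equiv.apply_symm_apply] at hi hj
    rw [← hi, ← hj] at this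
    exact Nat.lt_of_div_lt_div this

/-- At most `n` columns of blocks, each with few wide blocks. -/
theorem card_wide_blocks_le {k b n : ℕ} {P : Equiv.Perm (Fin k)} {M B : Finset (ℕ × ℕ)} (hb : 0 < b)
    (h : ¬ PatternOccurs P M) (hB : ∀ q ∈ B, q.1 < n)
    (hw : ∀ q ∈ B, k ≤ (blockColumns b M q).card) : B.card ≤ 2 ^ b * k * n := by
  have := Finset.card_le_mul_card_image_of_maps_to (f := Prod.fst) (s := B) (t := Finset.range n)
    (fun q hq => Finset.mem_range.2 (hB q hq)) (2 ^ b * k) (fun a _ => ?_)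
  · simpa using this
  · have hinj : ({q ∈ B | q.1 = a}.image Prod.snd).card = {q ∈ B | q.1 = a}.card := by
      refine Finset.card_image_of_injOn fun q hq q' hq' e => ?_
      simp only [Finset.coe_filter, Set.mem_ofPred_eq] at hq hq'
      exact Prod.ext (hq.2.trans hq'.2.symm) e
    rw [← hinj]
    refine card_wide_le hb h a _ fun r hr => ?_
    simp only [Finset.mem_image, Finset.mem_filter] at hr
    obtain ⟨q, ⟨hq, rfl⟩, rfl⟩ := hr
    exact hw q hq

/-- The Marcus–Tardos recursion: blocks meeting at least `k` columns or at least `k` rows are few,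
and each of the others has at most `k ^ 2` cells. -/
theorem card_le_of_contraction {k b n : ℕ} {P : Equiv.Perm (Fin k)} {M : Finset (ℕ × ℕ)}
    (hb : 0 < b) (h : ¬ PatternOccurs P M) (hM : ∀ p ∈ M, p.1 < b * n ∧ p.2 < b * n) :
    M.card ≤ k ^ 2 * (M.image (gridBlock b)).card + 2 * (b ^ 2 * (2 ^ b * k * n)) := by
  set B := M.image (gridBlock b) with hBdef
  have hBn : ∀ q ∈ B, q.1 < n ∧ q.2 < n := by
    intro q hq
    obtain ⟨p, hp, rfl⟩ := Finset.mem_image.1 hq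
    exact ⟨Nat.div_lt_of_lt_mul (hM p hp).1, Nat.div_lt_of_lt_mul (hM p hp).2⟩
  have hW : (B.filter fun q => k ≤ (blockColumns b M q).card).card ≤ 2 ^ b * k * n :=
    card_wide_blocks_le hb h (fun q hq => (hBn q (Finset.mem_filter.1 hq).1).1)
      fun q hq => (Finset.mem_filter.1 hq).2
  have hT : (B.filter fun q => k ≤ (blockRows b M q).card).card ≤ 2 ^ b * k * n := by
    rw [← Finset.card_image_of_injective _ Prod.swap_injective]
    refine card_wide_blocks_le (P := P.symm) (M := M.image Prod.swap) hb
      (fun h' => h h'.of_swap) ?_ ?_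
    · intro q hq
      obtain ⟨q, hq', rfl⟩ := Finset.mem_image.1 hq
      exact (hBn q (Finset.mem_filter.1 hq').1).2
    · intro q hq
      obtain ⟨q, hq', rfl⟩ := Finset.mem_image.1 hq
      rw [← blockRows_eq]
      exact (Finset.mem_filter.1 hq').2
  have hblock : ∀ q ∈ B, (M.filter fun p => gridBlock b p = q).card ≤
      k ^ 2 + ((if k ≤ (blockColumns b M q).card then b ^ 2 else 0) +
        (if k ≤ (blockRows b M q).card then b ^ 2 else 0)) := by
    intro q _
    have hbb := card_block_le hb M q
    by_cases h1 : k ≤ (blockColumns b M q).card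
    · rw [if_pos h1]; omega
    by_cases h2 : k ≤ (blockRows b M q).card
    · rw [if_pos h2]; omega
    have hsub : (M.filter fun p => gridBlock b p = q) ⊆ blockColumns b M q ×ˢ blockRows b M q :=
      fun p hp => Finset.mem_product.2
        ⟨Finset.mem_image_of_mem _ hp, Finset.mem_image_of_mem _ hp⟩
    have := Finset.card_le_card hsub
    rw [Finset.card_product] at this
    have h3 : (blockColumns b M q).card * (blockRows b M q).card ≤ k * k :=
      Nat.mul_le_mul (not_le.1 h1).le (not_le.1 h2).le
    rw [sq k]; omega
  have hsum := Finset.card_eq_sum_card_fiberwise (s := M) (t := B) (f := gridBlock b)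
    fun p hp => Finset.mem_image_of_mem _ hp
  rw [hsum]
  refine (Finset.sum_le_sum hblock).trans ?_
  rw [Finset.sum_add_distrib, Finset.sum_add_distrib, ← Finset.sum_filter, ← Finset.sum_filter]
  simp only [Finset.sum_const, smul_eq_mul]
  have e1 := Nat.mul_le_mul_right (b ^ 2) hW
  have e2 := Nat.mul_le_mul_right (b ^ 2) hT
  rw [mul_comm] at e1 e2
  linarith [mul_comm B.card (k ^ 2), mul_comm (b ^ 2) (2 ^ b * k * n),
    mul_comm (b ^ 2) ((B.filter fun q => k ≤ (blockColumns b M q).card).card),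
    mul_comm (b ^ 2) ((B.filter fun q => k ≤ (blockRows b M q).card).card)]

/-- The Füredi–Hajnal conjecture, for grids whose side is a power of a fixed `b > k ^ 2`: a set of
cells avoiding a pattern of length `k` has linearly many cells. -/
theorem exists_card_le_mul_of_not_patternOccurs {k : ℕ} (P : Equiv.Perm (Fin k)) {b : ℕ}
    (hb : k ^ 2 < b) : ∃ c : ℕ, ∀ (t : ℕ) (M : Finset (ℕ × ℕ)), ¬ PatternOccurs P M →
      (∀ p ∈ M, p.1 < b ^ t ∧ p.2 < b ^ t) → M.card ≤ c * b ^ t := by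
  refine ⟨2 * (b ^ 2 * (2 ^ b * k)) + 1, fun t => ?_⟩
  induction t with
  | zero =>
    intro M _ hM
    have : M ⊆ {(0, 0)} := fun p hp => by
      have := hM p hp
      simp only [pow_zero, Nat.lt_one_iff] at this
      simpa using Prod.ext this.1 this.2
    have := Finset.card_le_card this
    simp only [Finset.card_singleton] at this
    simp only [pow_zero, mul_one]
    omega
  | succ t ih =>
    intro M h hM
    have hb0 : 0 < b := by omega
    have hM' : ∀ p ∈ M, p.1 < b * b ^ t ∧ p.2 < b * b ^ t := by
      simpa only [pow_succ'] using hM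
    have h1 := card_le_of_contraction hb0 h hM'
    have h2 := ih (M.image (gridBlock b)) (fun h' => h h'.of_contraction) (by
      intro q hq
      obtain ⟨p, hp, rfl⟩ := Finset.mem_image.1 hq
      exact ⟨Nat.div_lt_of_lt_mul (hM' p hp).1, Nat.div_lt_of_lt_mul (hM' p hp).2⟩)
    set X := b ^ 2 * (2 ^ b * k) with hX
    calc M.card ≤ k ^ 2 * ((2 * X + 1) * b ^ t) + 2 * (X * b ^ t) := by
            refine h1.trans (add_le_add (Nat.mul_le_mul_left _ h2) (le_of_eq ?_))
            rw [hX]; ring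
      _ ≤ k ^ 2 * ((2 * X + 1) * b ^ t) + (2 * X + 1) * b ^ t := by nlinarith [Nat.zero_le (b ^ t)]
      _ = (k ^ 2 + 1) * ((2 * X + 1) * b ^ t) := by ring
      _ ≤ b * ((2 * X + 1) * b ^ t) := Nat.mul_le_mul_right _ hb
      _ = (2 * X + 1) * b ^ (t + 1) := by ring

open Classical in
/-- The subsets of an `N × N` grid avoiding the pattern `P`. -/
noncomputable def avoidingSets {k : ℕ} (P : Equiv.Perm (Fin k)) (N : ℕ) :
    Finset (Finset (ℕ × ℕ)) :=
  (Finset.range N ×ˢ Finset.range N).powerset.filter fun M => ¬ PatternOccurs P M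

theorem mem_avoidingSets {k N : ℕ} {P : Equiv.Perm (Fin k)} {M : Finset (ℕ × ℕ)} :
    M ∈ avoidingSets P N ↔ (∀ p ∈ M, p.1 < N ∧ p.2 < N) ∧ ¬ PatternOccurs P M := by
  simp only [avoidingSets, Finset.mem_filter, Finset.mem_powerset, Finset.subset_iff,
    Finset.mem_product, Finset.mem_range]

/-- A set with a given contraction `B` lies in the union of the blocks in `B`, so there are at most
`2 ^ (b ^ 2 * |B|)` such sets. -/
theorem card_fiber_contraction_le {b : ℕ} (hb : 0 < b) (F : Finset (Finset (ℕ × ℕ)))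
    (B : Finset (ℕ × ℕ)) : (F.filter fun M => M.image (gridBlock b) = B).card ≤
      2 ^ (b ^ 2 * B.card) := by
  let Z : Finset (ℕ × ℕ) := B.biUnion fun q =>
    Finset.Ico (q.1 * b) (q.1 * b + b) ×ˢ Finset.Ico (q.2 * b) (q.2 * b + b)
  have hZ : Z.card ≤ b ^ 2 * B.card := by
    have := Finset.card_biUnion_le_card_mul B (fun q =>
      Finset.Ico (q.1 * b) (q.1 * b + b) ×ˢ Finset.Ico (q.2 * b) (q.2 * b + b)) (b ^ 2)
      (fun q _ => by simp [sq])
    rwa [mul_comm]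
  have hsub : (F.filter fun M => M.image (gridBlock b) = B) ⊆ Z.powerset := by
    intro M hM
    rw [Finset.mem_powerset]
    intro p hp
    have hq : gridBlock b p ∈ B := (Finset.mem_filter.1 hM).2 ▸ Finset.mem_image_of_mem _ hp
    exact Finset.mem_biUnion.2 ⟨_, hq, Finset.mem_product.2
      ⟨div_eq_mem_Ico hb rfl, div_eq_mem_Ico hb rfl⟩⟩
  calc _ ≤ Z.powerset.card := Finset.card_le_card hsub
    _ = 2 ^ Z.card := Finset.card_powerset Z
    _ ≤ _ := Nat.pow_le_pow_right (by norm_num) hZ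

/-- Klazar's argument: contraction maps the sets avoiding `P` in a grid of side `b ^ (t + 1)` to
those in a grid of side `b ^ t`, and by the linear bound on the size of the latter each of them
has few preimages. -/
theorem exists_card_avoidingSets_le {k : ℕ} (P : Equiv.Perm (Fin k)) {b : ℕ} (hb : k ^ 2 < b)
    (hb2 : 2 ≤ b) : ∃ G : ℕ, 0 < G ∧ ∀ t, (avoidingSets P (b ^ t)).card ≤ G ^ b ^ t := by
  obtain ⟨c, hc⟩ := exists_card_le_mul_of_not_patternOccurs P hb
  have hb0 : 0 < b := by omega
  refine ⟨2 * 2 ^ (b ^ 2 * c), by positivity, fun t => ?_⟩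
  induction t with
  | zero =>
    have : (avoidingSets P (b ^ 0)).card ≤ 2 := by
      classical
      refine (Finset.card_le_card (Finset.filter_subset _ _)).trans ?_
      simp
    have h1 : 0 < 2 ^ (b ^ 2 * c) := by positivity
    rw [pow_zero, pow_one]
    rw [pow_zero] at this
    omega
  | succ t ih =>
    set Q := 2 ^ (b ^ 2 * c) with hQ
    have hstep : (avoidingSets P (b ^ (t + 1))).card ≤
        Q ^ b ^ t * (avoidingSets P (b ^ t)).card := by
      refine Finset.card_le_mul_card_image_of_maps_to (f := fun M => M.image (gridBlock b))
        (fun M hM => ?_) _ fun B hB => ?_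
      · rw [mem_avoidingSets] at hM ⊢
        refine ⟨fun q hq => ?_, fun h => hM.2 h.of_contraction⟩
        obtain ⟨p, hp, rfl⟩ := Finset.mem_image.1 hq
        have := hM.1 p hp
        rw [pow_succ'] at this
        exact ⟨Nat.div_lt_of_lt_mul this.1, Nat.div_lt_of_lt_mul this.2⟩
      · refine (card_fiber_contraction_le hb0 _ B).trans ?_
        rw [hQ, ← pow_mul]
        rw [mem_avoidingSets] at hB
        refine Nat.pow_le_pow_right (by norm_num) ?_
        have := Nat.mul_le_mul_left (b ^ 2) (hc t B hB.2 hB.1)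
        rwa [← mul_assoc] at this
    calc _ ≤ Q ^ b ^ t * (2 * Q) ^ b ^ t := hstep.trans (Nat.mul_le_mul_left _ ih)
      _ ≤ (2 * Q) ^ b ^ t * (2 * Q) ^ b ^ t := by gcongr; omega
      _ = (2 * Q) ^ (b ^ t * 2) := by rw [← pow_add]; congr 1; ring
      _ ≤ (2 * Q) ^ b ^ (t + 1) := by
        refine Nat.pow_le_pow_right (by positivity) ?_
        rw [pow_succ]
        exact Nat.mul_le_mul_left _ hb2

/-- The Stanley–Wilf bound: permutations avoiding `β` are determined by their graphs, which avoid
the matrix of `β`. -/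
theorem exists_ncard_not_isContainedIn_le (β : Permutation) : ∃ K : ℕ, ∀ n : ℕ,
    {π : Equiv.Perm (Fin n) | ¬ β.IsContainedIn ⟨n, π⟩}.ncard ≤ K ^ n := by
  obtain ⟨k, P⟩ := β
  obtain ⟨G, hG0, hG⟩ := exists_card_avoidingSets_le P (b := k ^ 2 + 2) (by omega) (by omega)
  set b := k ^ 2 + 2 with hb
  refine ⟨G ^ b, fun n => ?_⟩
  rcases Nat.eq_zero_or_pos n with rfl | hn
  · exact (Set.ncard_le_one_of_subsingleton _).trans (by simp)
  -- the least power of `b` that is at least `n` is at most `b * n`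
  obtain ⟨t, hnt, htn⟩ : ∃ t, n ≤ b ^ t ∧ b ^ t ≤ b * n := by
    refine ⟨Nat.log b n + 1, (Nat.lt_pow_succ_log_self (by omega) n).le, ?_⟩
    rw [pow_succ']
    exact Nat.mul_le_mul_left _ (Nat.pow_log_le_self b (by omega))
  let graph : Equiv.Perm (Fin n) → Finset (ℕ × ℕ) := fun π =>
    Finset.univ.image fun i : Fin n => ((i : ℕ), (π i : ℕ))
  have hmaps : ∀ π ∈ {π : Equiv.Perm (Fin n) | ¬ Permutation.IsContainedIn ⟨k, P⟩ ⟨n, π⟩},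
      graph π ∈ (avoidingSets P (b ^ t) : Set (Finset (ℕ × ℕ))) := by
    intro π hπ
    rw [Finset.mem_coe, mem_avoidingSets]
    constructor
    · intro p hp
      obtain ⟨i, -, rfl⟩ := Finset.mem_image.1 hp
      exact ⟨i.2.trans_le hnt, (π i).2.trans_le hnt⟩
    · rintro ⟨f, g, hf, hg, h⟩
      apply hπ
      simp only [graph, Finset.mem_image, Finset.mem_univ, true_and, Prod.mk.injEq] at h
      choose e he1 he2 using h
      refine ⟨OrderEmbedding.ofStrictMono e fun i j hij => ?_, fun i j => ?_⟩
      · rw [Fin.lt_def, he1, he1]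
        exact hf hij
      · change P i < P j ↔ π (e i) < π (e j)
        rw [Fin.lt_def (a := π (e i)), he2, he2, hg.lt_iff_lt]
  have hinj : Function.Injective graph := by
    intro π π' h
    ext i
    have : ((i : ℕ), (π i : ℕ)) ∈ graph π' := h ▸ Finset.mem_image_of_mem _ (Finset.mem_univ i)
    obtain ⟨j, -, hj⟩ := Finset.mem_image.1 this
    simp only [Prod.mk.injEq] at hj
    obtain rfl := Fin.ext hj.1
    exact hj.2.symm
  calc _ ≤ (avoidingSets P (b ^ t) : Set (Finset (ℕ × ℕ))).ncard :=
        Set.ncard_le_ncard_of_injOn graph hmaps hinj.injOn (Finset.finite_toSet _)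
    _ = (avoidingSets P (b ^ t)).card := Set.ncard_coe_finset _
    _ ≤ G ^ b ^ t := hG t
    _ ≤ G ^ (b * n) := Nat.pow_le_pow_right hG0 htn
    _ = (G ^ b) ^ n := pow_mul _ _ _

/-! ### Rational series and the transfer matrix method -/

/-- A family of sequences satisfying a first-order linear recurrence has rational generating
functions: the series are the entries of `(1 - X M)⁻¹ v`, and Cramer's rule applies. -/
theorem isRationalSeries_of_linear_recurrence {σ : Type*} [Fintype σ] [DecidableEq σ]
    (T : Matrix σ σ ℚ) (v : ℕ → σ → ℚ) (hv : ∀ n s, v (n + 1) s = ∑ t, T s t * v n t) (s : σ) :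
    IsRationalSeries (PowerSeries.mk fun n => v n s) := by
  classical
  let N : Matrix σ σ (Polynomial ℚ) := 1 - Matrix.of fun a b => Polynomial.C (T a b) * Polynomial.X
  let φ : Polynomial ℚ →+* PowerSeries ℚ := Polynomial.coeToPowerSeries.ringHom
  let F : σ → PowerSeries ℚ := fun s => PowerSeries.mk fun n => v n s
  have hNF : (φ.mapMatrix N).mulVec F = fun a => φ (Polynomial.C (v 0 a)) := by
    funext a
    have h1 : φ.mapMatrix N = 1 - Matrix.of fun a b => φ (Polynomial.C (T a b) * Polynomial.X) := by
      rw [map_sub, map_one]; rfl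
    rw [h1, Matrix.sub_mulVec, Matrix.one_mulVec, Pi.sub_apply]
    ext n
    simp only [Matrix.mulVec, dotProduct, Matrix.of_apply, φ, F,
      Polynomial.coeToPowerSeries.ringHom_apply, Polynomial.coe_mul, Polynomial.coe_C,
      Polynomial.coe_X, map_sub, map_sum, mul_assoc, PowerSeries.coeff_C_mul, PowerSeries.coeff_mk]
    rcases n with _ | n
    · simp [PowerSeries.coeff_C]
    · simp only [PowerSeries.coeff_succ_X_mul, PowerSeries.coeff_mk, hv, sub_self,
        PowerSeries.coeff_C, Nat.add_eq_zero_iff, one_ne_zero, and_false, if_false]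
  have hdet : φ N.det * F s = φ (N.adjugate.mulVec (fun a => Polynomial.C (v 0 a)) s) := by
    have h2 : (φ.mapMatrix N.adjugate).mulVec ((φ.mapMatrix N).mulVec F) = φ N.det • F := by
      rw [RingHom.map_adjugate, Matrix.mulVec_mulVec, Matrix.adjugate_mul, Matrix.smul_mulVec,
        Matrix.one_mulVec, RingHom.map_det]
    rw [hNF] at h2
    have := congrFun h2 s
    rw [Pi.smul_apply, smul_eq_mul] at this
    rw [← this]
    simp [Matrix.mulVec, dotProduct, map_sum, map_mul]
  refine ⟨_, N.det, ?_, (mul_comm _ _).trans hdet⟩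
  rw [Polynomial.coeff_zero_eq_eval_zero, ← Polynomial.coe_evalRingHom, RingHom.map_det]
  have : (Polynomial.evalRingHom (0 : ℚ)).mapMatrix N = 1 := by
    rw [map_sub, map_one]
    have : (Polynomial.evalRingHom (0 : ℚ)).mapMatrix
        (Matrix.of fun a b => Polynomial.C (T a b) * Polynomial.X) = 0 := by
      ext a b; simp
    rw [this, sub_zero]
  rw [this, Matrix.det_one]
  exact one_ne_zero

/-- `S` is a set of initially occupied places and `w i` is the offset from `i` of the place taken at
step `i`: in `n` steps, distinct free places are taken and exactly the places below `n + k` end up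
occupied. -/
def IsFilling {m : ℕ} (k n : ℕ) (S : Finset (Fin m)) (w : Fin n → Fin m) : Prop :=
  Function.Injective (fun i : Fin n => (i : ℕ) + w i) ∧
  (∀ i : Fin n, ∀ s ∈ S, (s : ℕ) ≠ i + w i) ∧
  ∀ x : ℕ, ((∃ s ∈ S, (s : ℕ) = x) ∨ ∃ i : Fin n, (i : ℕ) + w i = x) ↔ x < n + k

/-- The set of occupied places, renumbered after dropping the place `0`. -/
def shiftState {m : ℕ} (S : Finset (Fin m)) : Finset (Fin m) :=
  Finset.univ.filter fun x => ∃ y ∈ S, (y : ℕ) = x + 1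

theorem exists_mem_shiftState {m : ℕ} (S : Finset (Fin m)) (x : ℕ) :
    (∃ s ∈ shiftState S, (s : ℕ) = x) ↔ ∃ y ∈ S, (y : ℕ) = x + 1 := by
  simp only [shiftState, Finset.mem_filter, Finset.mem_univ, true_and]
  constructor
  · rintro ⟨s, h, rfl⟩
    exact h
  · rintro ⟨y, hy, h⟩
    exact ⟨⟨x, by omega⟩, ⟨y, hy, h⟩, rfl⟩

/-- The first step of a filling: a free place `o` is taken, and the place `0`, which later steps
cannot reach, must be occupied by then. -/
theorem isFilling_cons {m k n : ℕ} (S : Finset (Fin m)) (o : Fin m) (w : Fin n → Fin m) :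
    IsFilling k (n + 1) S (Fin.cons o w : Fin (n + 1) → Fin m) ↔
      (o ∉ S ∧ ∃ z ∈ insert o S, (z : ℕ) = 0) ∧ IsFilling k n (shiftState (insert o S)) w := by
  have hne : (∀ i : Fin n, ∀ s ∈ shiftState (insert o S), (s : ℕ) ≠ i + w i) ↔
      (∀ i : Fin n, ∀ s ∈ insert o S, (s : ℕ) ≠ i + w i + 1) := by
    refine forall_congr' fun i => ?_
    have := not_congr (exists_mem_shiftState (insert o S) (i + w i))
    push Not at this
    exact this
  rw [IsFilling, IsFilling, hne]
  simp only [exists_mem_shiftState]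
  have hinj : Function.Injective (fun i : Fin (n + 1) =>
      (i : ℕ) + ((Fin.cons o w : Fin (n + 1) → Fin m) i : ℕ)) ↔
      Function.Injective (fun i : Fin n => (i : ℕ) + w i) ∧
        ∀ i : Fin n, (o : ℕ) ≠ i + w i + 1 := by
    constructor
    · refine fun h => ⟨fun i j hij => ?_, fun i hi => ?_⟩
      · have := @h i.succ j.succ (by simp at hij ⊢; omega)
        exact Fin.succ_injective _ this
      · have := @h 0 i.succ (by simp; omega)
        exact (Fin.succ_ne_zero i) this.symm
    · rintro ⟨h1, h2⟩ i j
      refine Fin.cases ?_ (fun i => ?_) i <;> refine Fin.cases ?_ (fun j => ?_) j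
      · simp
      · intro h; have := h2 j; simp at h; omega
      · intro h; have := h2 i; simp at h; omega
      · intro h
        rw [@h1 i j (by simp at h ⊢; omega)]
  rw [hinj]
  simp only [Fin.forall_fin_succ, Fin.exists_fin_succ, Fin.cons_zero, Fin.cons_succ, Fin.val_zero,
    Fin.val_succ, zero_add, Finset.mem_insert, forall_eq_or_imp, exists_eq_or_imp]
  have hz : (∀ x : ℕ, (∃ s ∈ S, (s : ℕ) = x) ∨ ((o : ℕ) = x ∨ ∃ i : Fin n, (i : ℕ) + 1 + w i = x) ↔
      x < n + 1 + k) ↔ (((o : ℕ) = 0 ∨ ∃ z ∈ S, (z : ℕ) = 0) ∧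
      ∀ x : ℕ, (((o : ℕ) = x + 1 ∨ ∃ y ∈ S, (y : ℕ) = x + 1) ∨ ∃ i : Fin n, (i : ℕ) + w i = x) ↔
        x < n + k) := by
    have hI : ∀ x : ℕ, (∃ i : Fin n, (i : ℕ) + 1 + w i = x + 1) ↔ ∃ i : Fin n, (i : ℕ) + w i = x :=
      fun x => exists_congr fun i => by omega
    constructor
    · intro h
      constructor
      · rcases (h 0).2 (by omega) with h | h | ⟨i, h⟩
        · exact .inr h
        · exact .inl h
        · omega
      · intro x
        have := h (x + 1)
        rw [show x + 1 < n + 1 + k ↔ x < n + k by omega] at this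
        rw [← this, hI x]
        exact or_assoc.trans or_left_comm
    · rintro ⟨h0, h⟩ x
      rcases x with _ | x
      · refine ⟨fun _ => by omega, fun _ => ?_⟩
        rcases h0 with h0 | h0
        · exact .inr (.inl h0)
        · exact .inl h0
      · rw [show x + 1 < n + 1 + k ↔ x < n + k by omega, ← h x, hI x]
        exact (or_assoc.trans or_left_comm).symm
  rw [hz]
  have ho : (∀ s ∈ S, (s : ℕ) ≠ o) ↔ o ∉ S :=
    ⟨fun h hs => h o hs rfl, fun h s hs e => h (Fin.ext e ▸ hs)⟩
  rw [ho]
  have hi : (∀ i : Fin n, ∀ s ∈ S, (s : ℕ) ≠ i + 1 + w i) ↔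
      ∀ i : Fin n, ∀ s ∈ S, (s : ℕ) ≠ i + w i + 1 := by
    simp only [add_right_comm]
  rw [hi]
  constructor
  · rintro ⟨⟨a, b⟩, ⟨c, d⟩, e, f⟩
    exact ⟨⟨c, e⟩, a, fun i => ⟨b i, d i⟩, f⟩
  · rintro ⟨⟨c, e⟩, a, b, f⟩
    exact ⟨⟨a, fun i => (b i).1⟩, ⟨c, fun i => (b i).2⟩, e, f⟩

open Classical in
/-- The transfer matrix: the number of ways to pass from the state `S` to the state `S'`. -/
noncomputable def fillingMatrix (m : ℕ) : Matrix (Finset (Fin m)) (Finset (Fin m)) ℚ :=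
  Matrix.of fun S S' => ((Finset.univ.filter fun o : Fin m =>
    (o ∉ S ∧ ∃ z ∈ insert o S, (z : ℕ) = 0) ∧ shiftState (insert o S) = S').card : ℚ)

open Classical in
theorem card_isFilling_succ (m k n : ℕ) (S : Finset (Fin m)) :
    ((Finset.univ.filter fun w => IsFilling k (n + 1) S w).card : ℚ) =
      ∑ S', fillingMatrix m S S' * ((Finset.univ.filter fun w => IsFilling k n S' w).card : ℚ) := by
  have h1 : (Finset.univ.filter fun w => IsFilling k (n + 1) S w).card =
      ∑ o : Fin m, if (o ∉ S ∧ ∃ z ∈ insert o S, (z : ℕ) = 0) then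
        (Finset.univ.filter fun w => IsFilling k n (shiftState (insert o S)) w).card else 0 := by
    rw [Finset.card_eq_sum_card_fiberwise (t := Finset.univ) (f := fun w => w 0)
      (fun _ _ => Finset.mem_coe.2 (Finset.mem_univ _))]
    refine Finset.sum_congr rfl fun o _ => ?_
    have hfib : ((Finset.univ.filter fun w => IsFilling k (n + 1) S w).filter fun w => w 0 = o) =
        (Finset.univ.filter fun w => (o ∉ S ∧ ∃ z ∈ insert o S, (z : ℕ) = 0) ∧
          IsFilling k n (shiftState (insert o S)) w).image
          fun w => (Fin.cons o w : Fin (n + 1) → Fin m) := by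
      ext w
      simp only [Finset.mem_filter, Finset.mem_univ, true_and, Finset.mem_image]
      constructor
      · rintro ⟨h, rfl⟩
        refine ⟨Fin.tail w, ?_, Fin.cons_self_tail w⟩
        rwa [← isFilling_cons, Fin.cons_self_tail]
      · rintro ⟨w', h, rfl⟩
        exact ⟨(isFilling_cons _ _ _).2 h, rfl⟩
    rw [hfib, Finset.card_image_of_injective _ (Fin.cons_right_injective (α := fun _ => Fin m) o)]
    split_ifs with h
    · simp only [h, true_and, not_false_eq_true]
    · simp only [h, false_and, Finset.filter_false, Finset.card_empty]
  rw [h1]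
  push_cast
  simp only [fillingMatrix, Matrix.of_apply, Finset.card_filter, Nat.cast_sum, Finset.sum_mul]
  rw [Finset.sum_comm]
  refine Finset.sum_congr rfl fun o _ => ?_
  rw [Finset.sum_eq_single (shiftState (insert o S))]
  · by_cases h : (o ∉ S ∧ ∃ z ∈ insert o S, (z : ℕ) = 0)
    · rw [if_pos h, if_pos ⟨h, rfl⟩]; simp
    · rw [if_neg h, if_neg (fun h' => h h'.1)]; simp
  · intro S' _ hS'
    rw [if_neg (fun h' => hS' h'.2.symm)]; simp
  · simp

/-- The permutations `π` with `|π i - i| ≤ k` for all `i`. -/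
def bandPermutations (k n : ℕ) : Set (Equiv.Perm (Fin n)) :=
  {π | ∀ i, (π i : ℕ) ≤ i + k ∧ (i : ℕ) ≤ π i + k}

open Classical in
/-- A permutation of displacement at most `k` corresponds to the filling with offsets `π i + k - i`,
the values being shifted by `k`, so that the places below `k` are occupied from the start. -/
theorem ncard_bandPermutations (k n : ℕ) : (bandPermutations k n).ncard =
    (Finset.univ.filter fun w : Fin n → Fin (2 * k + 1) =>
      IsFilling k n (Finset.univ.filter fun s : Fin (2 * k + 1) => (s : ℕ) < k) w).card := by
  rw [← Set.ncard_coe_finset]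
  refine Set.ncard_congr
    (fun π hπ i => ⟨π i + k - i, by have := hπ i; omega⟩) ?_ ?_ ?_
  · intro π hπ
    have hval : ∀ i : Fin n, (i : ℕ) + ((π i : ℕ) + k - i) = π i + k := fun i => by
      have := hπ i; omega
    simp only [Finset.coe_filter, Finset.mem_univ, true_and, Set.mem_ofPred_eq]
    refine ⟨fun i j hij => ?_, fun i s hs => ?_, fun x => ?_⟩
    · simp only [hval] at hij
      exact π.injective (Fin.ext (by omega))
    · simp only [Finset.mem_filter, Finset.mem_univ, true_and] at hs
      simp only [hval]; omega
    · simp only [hval, Finset.mem_filter, Finset.mem_univ, true_and]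
      constructor
      · rintro (⟨s, hs, rfl⟩ | ⟨i, rfl⟩)
        · omega
        · have := (π i).2; omega
      · intro hx
        rcases lt_or_ge x k with h | h
        · exact .inl ⟨⟨x, by omega⟩, h, rfl⟩
        · exact .inr ⟨π.symm ⟨x - k, by omega⟩, by simp; omega⟩
  · intro π π' hπ hπ' h
    ext i
    have := congrArg Fin.val (congrFun h i)
    have h1 := hπ i
    have h2 := hπ' i
    simp only at this
    omega
  · intro w hw
    simp only [Finset.coe_filter, Finset.mem_univ, true_and, Set.mem_ofPred_eq] at hw
    obtain ⟨hinj, hne, himg⟩ := hw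
    have hlt : ∀ i : Fin n, (i : ℕ) + w i < n + k := fun i => (himg _).1 (.inr ⟨i, rfl⟩)
    have hge : ∀ i : Fin n, k ≤ (i : ℕ) + w i := fun i => by
      by_contra! h
      exact hne i ⟨(i : ℕ) + w i, by omega⟩ (by simpa using h) rfl
    let f : Fin n → Fin n := fun i => ⟨i + w i - k, by have := hlt i; have := i.2; omega⟩
    have hf : Function.Injective f := by
      intro i j hij
      have h0 := congrArg Fin.val hij
      have h1 := hge i
      have h2 := hge j
      simp only [f] at h0
      exact hinj (by simp only; omega)
    refine ⟨Equiv.ofBijective f (Finite.injective_iff_bijective.1 hf), fun i => ?_, ?_⟩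
    · have h1 := hge i
      have := (w i).2
      simp only [Equiv.ofBijective_apply, f]
      omega
    · funext i
      have h1 := hge i
      ext
      simp only [Equiv.ofBijective_apply, f]
      omega

theorem isRationalSeries_bandPermutations (k : ℕ) :
    IsRationalSeries (PowerSeries.mk fun n => ((bandPermutations k n).ncard : ℚ)) := by
  classical
  have := isRationalSeries_of_linear_recurrence (fillingMatrix (2 * k + 1))
    (fun n S => ((Finset.univ.filter fun w => IsFilling k n S w).card : ℚ))
    (card_isFilling_succ _ k) (Finset.univ.filter fun s : Fin (2 * k + 1) => (s : ℕ) < k)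
  convert this using 3 with n
  rw [ncard_bandPermutations]

/-! ### Direct sums and indecomposable permutations -/

namespace Permutation

theorem IsContainedIn.trans {σ τ π : Permutation} (h : σ.IsContainedIn τ)
    (h' : τ.IsContainedIn π) : σ.IsContainedIn π := by
  obtain ⟨f, hf⟩ := h
  obtain ⟨g, hg⟩ := h'
  exact ⟨f.trans g, fun i j => (hf i j).trans (hg _ _)⟩

theorem IsContainedIn.refl (σ : Permutation) : σ.IsContainedIn σ :=
  ⟨RelEmbedding.refl _, fun _ _ => Iff.rfl⟩

/-- The first `j` entries of `π` are its `j` smallest values. -/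
def IsCut (π : Permutation) (j : ℕ) : Prop :=
  ∀ i : Fin π.1, (π.2 i : ℕ) < j ↔ (i : ℕ) < j

/-- A permutation is indecomposable if it is not the sum of two shorter ones; the empty
permutation is not indecomposable. -/
def IsIndecomposable (π : Permutation) : Prop :=
  0 < π.1 ∧ ∀ j, 0 < j → j < π.1 → ¬ π.IsCut j

/-- The direct sum `σ ⊕ τ`: the entries of `τ` are placed to the right of and above those
of `σ`. -/
def directSum (σ τ : Permutation) : Permutation :=
  ⟨σ.1 + τ.1, finSumFinEquiv.permCongr (Equiv.sumCongr σ.2 τ.2)⟩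

theorem directSum_castAdd (σ τ : Permutation) (i : Fin σ.1) :
    (directSum σ τ).2 (Fin.castAdd τ.1 i) = Fin.castAdd τ.1 (σ.2 i) := by
  change finSumFinEquiv.permCongr (Equiv.sumCongr σ.2 τ.2) (Fin.castAdd τ.1 i) = _
  rw [Equiv.permCongr_apply, finSumFinEquiv_symm_apply_castAdd]
  rfl

theorem directSum_natAdd (σ τ : Permutation) (i : Fin τ.1) :
    (directSum σ τ).2 (Fin.natAdd σ.1 i) = Fin.natAdd σ.1 (τ.2 i) := by
  change finSumFinEquiv.permCongr (Equiv.sumCongr σ.2 τ.2) (Fin.natAdd σ.1 i) = _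
  rw [Equiv.permCongr_apply, finSumFinEquiv_symm_apply_natAdd]
  rfl

theorem isCut_of_forall_lt {π : Permutation} {j : ℕ} (hj : j ≤ π.1)
    (h : ∀ i i' : Fin π.1, (i : ℕ) < j → j ≤ i' → π.2 i < π.2 i') : π.IsCut j := by
  obtain ⟨n, π⟩ := π
  simp only at hj h
  intro i
  change (π i : ℕ) < j ↔ (i : ℕ) < j
  constructor
  · intro hi
    by_contra! hji
    have : (Finset.univ : Finset (Fin j)).card ≤ (Finset.range (π i)).card := by
      refine Finset.card_le_card_of_injOn (fun x => (π (Fin.castLE hj x) : ℕ)) (fun x _ => ?_)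
        (fun x _ y _ hxy => ?_)
      · simpa using h (Fin.castLE hj x) i x.2 hji
      · exact Fin.castLE_injective hj (π.injective (Fin.ext hxy))
    simp at this
    omega
  · intro hi
    have : (Finset.univ : Finset (Fin (n - j))).card ≤ (Finset.Ioo (π i : ℕ) n).card := by
      refine Finset.card_le_card_of_injOn (fun x => (π ⟨j + x, by omega⟩ : ℕ)) (fun x _ => ?_)
        (fun x _ y _ hxy => ?_)
      · simpa using h i ⟨j + x, by omega⟩ hi (by simp)
      · have := Fin.ext_iff.1 (π.injective (Fin.ext hxy))
        simp only at this
        exact Fin.ext (by omega)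
    simp at this
    omega

theorem isCut_directSum_iff {σ τ : Permutation} {j : ℕ} (hj : j ≤ σ.1) :
    (directSum σ τ).IsCut j ↔ σ.IsCut j := by
  constructor
  · intro h i
    have := h (Fin.castAdd τ.1 i)
    rw [directSum_castAdd] at this
    simpa using this
  · intro h i
    change Fin (σ.1 + τ.1) at i
    refine Fin.addCases (fun i => ?_) (fun i => ?_) i
    · rw [directSum_castAdd]
      simpa using h i
    · rw [directSum_natAdd]
      simp only [Fin.val_natAdd]
      omega

theorem isCut_length (π : Permutation) : π.IsCut π.1 :=
  fun i => iff_of_true (π.2 i).2 i.2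

theorem exists_directSum_eq {π : Permutation} {j : ℕ} (hj : j ≤ π.1) (h : π.IsCut j) :
    ∃ σ τ : Permutation, σ.1 = j ∧ directSum σ τ = π := by
  obtain ⟨n, π⟩ := π
  obtain ⟨m, rfl⟩ := Nat.exists_eq_add_of_le hj
  have h' : ∀ i, (π i : ℕ) < j ↔ (i : ℕ) < j := h
  let f : Fin j → Fin j := fun i => ⟨π (Fin.castAdd m i), (h' _).2 i.2⟩
  have hge : ∀ i : Fin m, j ≤ π (Fin.natAdd j i) := fun i => by
    have := h' (Fin.natAdd j i)
    simp only [Fin.val_natAdd] at this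
    omega
  let g : Fin m → Fin m := fun i => ⟨π (Fin.natAdd j i) - j, by have := hge i; omega⟩
  have hf : Function.Injective f := fun x y hxy => by
    have h1 := congrArg Fin.val hxy
    exact Fin.castAdd_injective j m (π.injective (Fin.ext h1))
  have hg : Function.Injective g := fun x y hxy => by
    have h1 := congrArg Fin.val hxy
    have h2 := hge x
    have h3 := hge y
    simp only [g] at h1
    exact Fin.natAdd_injective m j (π.injective (Fin.ext (by omega)))
  let σ : Permutation := ⟨j, Equiv.ofBijective f (Finite.injective_iff_bijective.1 hf)⟩
  let τ : Permutation := ⟨m, Equiv.ofBijective g (Finite.injective_iff_bijective.1 hg)⟩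
  refine ⟨σ, τ, rfl, ?_⟩
  change (⟨j + m, (directSum σ τ).2⟩ : Permutation) = ⟨j + m, π⟩
  congr 1
  ext i
  refine Fin.addCases (fun i => ?_) (fun i => ?_) i
  · exact congrArg Fin.val (directSum_castAdd σ τ i)
  · refine (congrArg Fin.val (directSum_natAdd σ τ i)).trans ?_
    simp only [σ, τ, Fin.val_natAdd, Equiv.ofBijective_apply, g]
    have := hge i
    omega

theorem directSum_inj_of_length_eq {σ τ σ' τ' : Permutation} (hl : σ.1 = σ'.1)
    (h : directSum σ τ = directSum σ' τ') : σ = σ' ∧ τ = τ' := by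
  obtain ⟨m, s⟩ := σ
  obtain ⟨m', s'⟩ := σ'
  obtain ⟨n, t⟩ := τ
  obtain ⟨n', t'⟩ := τ'
  obtain rfl : m = m' := hl
  obtain rfl : n = n' := by
    have : m + n = m + n' := congrArg Sigma.fst h
    omega
  have h2 : (directSum ⟨m, s⟩ ⟨n, t⟩).2 = (directSum ⟨m, s'⟩ ⟨n, t'⟩).2 :=
    eq_of_heq (Sigma.mk.inj_iff.1 h).2
  constructor
  · congr 1
    ext i
    have := (directSum_castAdd ⟨m, s⟩ ⟨n, t⟩ i).symm.trans
      ((DFunLike.congr_fun h2 _).trans (directSum_castAdd ⟨m, s'⟩ ⟨n, t'⟩ i))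
    have := congrArg Fin.val this
    exact this
  · congr 1
    ext i
    have := (directSum_natAdd ⟨m, s⟩ ⟨n, t⟩ i).symm.trans
      ((DFunLike.congr_fun h2 _).trans (directSum_natAdd ⟨m, s'⟩ ⟨n, t'⟩ i))
    have := congrArg Fin.val this
    simpa using this

/-- The first summand is determined if it is indecomposable. -/
theorem directSum_inj {σ τ σ' τ' : Permutation} (hσ : σ.IsIndecomposable)
    (hσ' : σ'.IsIndecomposable) (h : directSum σ τ = directSum σ' τ') : σ = σ' ∧ τ = τ' := by
  refine directSum_inj_of_length_eq ?_ h
  rcases lt_trichotomy σ.1 σ'.1 with hlt | heq | hlt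
  · refine absurd ?_ (hσ'.2 σ.1 hσ.1 hlt)
    rw [← isCut_directSum_iff (τ := τ') hlt.le, ← h, isCut_directSum_iff le_rfl]
    exact isCut_length σ
  · exact heq
  · refine absurd ?_ (hσ.2 σ'.1 hσ'.1 hlt)
    rw [← isCut_directSum_iff (τ := τ) hlt.le, h, isCut_directSum_iff le_rfl]
    exact isCut_length σ'

theorem exists_indecomposable_directSum_eq {π : Permutation} (hπ : 0 < π.1) :
    ∃ σ τ : Permutation, σ.IsIndecomposable ∧ directSum σ τ = π := by
  classical
  have hex : ∃ j, 0 < j ∧ π.IsCut j := ⟨π.1, hπ, isCut_length π⟩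
  have hle : Nat.find hex ≤ π.1 := Nat.find_min' hex ⟨hπ, isCut_length π⟩
  obtain ⟨σ, τ, hσ, rfl⟩ := exists_directSum_eq hle (Nat.find_spec hex).2
  refine ⟨σ, τ, ⟨hσ ▸ (Nat.find_spec hex).1, fun j hj hjσ hcut => ?_⟩, rfl⟩
  exact Nat.find_min hex (hσ ▸ hjσ) ⟨hj, (isCut_directSum_iff hjσ.le).2 hcut⟩

theorem isContainedIn_directSum_left (σ τ : Permutation) : σ.IsContainedIn (directSum σ τ) := by
  refine ⟨Fin.castAddOrderEmb τ.1, fun i j => ?_⟩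
  have hi := directSum_castAdd σ τ i
  have hj := directSum_castAdd σ τ j
  change _ ↔ (directSum σ τ).2 (Fin.castAdd τ.1 i) < (directSum σ τ).2 (Fin.castAdd τ.1 j)
  rw [hi, hj]
  rfl

theorem isContainedIn_directSum_right (σ τ : Permutation) : τ.IsContainedIn (directSum σ τ) := by
  refine ⟨Fin.natAddOrderEmb σ.1, fun i j => ?_⟩
  have hi := directSum_natAdd σ τ i
  have hj := directSum_natAdd σ τ j
  change _ ↔ (directSum σ τ).2 (Fin.natAdd σ.1 i) < (directSum σ τ).2 (Fin.natAdd σ.1 j)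
  rw [hi, hj]
  change _ ↔ σ.1 + (τ.2 i : ℕ) < σ.1 + (τ.2 j : ℕ)
  rw [Nat.add_lt_add_iff_left, Fin.lt_def]

theorem directSum_val_lt_iff {σ τ : Permutation} (i : Fin (directSum σ τ).1) :
    ((directSum σ τ).2 i : ℕ) < σ.1 ↔ (i : ℕ) < σ.1 :=
  (isCut_directSum_iff le_rfl).2 (isCut_length σ) i

/-- An indecomposable permutation contained in a direct sum is contained in one of the summands:
otherwise the entries placed in the first summand would form a cut. -/
theorem IsIndecomposable.isContainedIn_of_directSum {κ σ τ : Permutation}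
    (hκ : κ.IsIndecomposable) (h : κ.IsContainedIn (directSum σ τ)) :
    κ.IsContainedIn σ ∨ κ.IsContainedIn τ := by
  obtain ⟨f, hf⟩ := h
  by_cases hl : ∀ i, (f i : ℕ) < σ.1
  · left
    have hv : ∀ i, ((directSum σ τ).2 (f i) : ℕ) = σ.2 ⟨f i, hl i⟩ := fun i =>
      congrArg Fin.val (directSum_castAdd σ τ ⟨f i, hl i⟩)
    refine ⟨OrderEmbedding.ofStrictMono (fun i => ⟨f i, hl i⟩)
      fun i j hij => f.strictMono hij, fun i j => ?_⟩
    rw [hf, Fin.lt_def, hv, hv, ← Fin.lt_def]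
    rfl
  by_cases hr : ∀ i, σ.1 ≤ (f i : ℕ)
  · right
    have hlt : ∀ i, (f i : ℕ) - σ.1 < τ.1 := fun i => by
      have h1 : (f i : ℕ) < σ.1 + τ.1 := (f i).2
      have := hr i
      omega
    have hv : ∀ i, ((directSum σ τ).2 (f i) : ℕ) = σ.1 + τ.2 ⟨f i - σ.1, hlt i⟩ := fun i => by
      have h1 : f i = Fin.natAdd σ.1 ⟨f i - σ.1, hlt i⟩ := Fin.ext (by simp [hr i])
      have h2 := directSum_natAdd σ τ ⟨f i - σ.1, hlt i⟩
      rw [← h1] at h2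
      exact congrArg Fin.val h2
    refine ⟨OrderEmbedding.ofStrictMono (fun i => ⟨f i - σ.1, hlt i⟩)
      fun i j hij => ?_, fun i j => ?_⟩
    · have h1 : (f i : ℕ) < f j := f.strictMono hij
      have := hr i
      simp only [Fin.lt_def]
      omega
    · rw [hf, Fin.lt_def, hv, hv, Nat.add_lt_add_iff_left, ← Fin.lt_def]
      rfl
  exfalso
  push Not at hl hr
  -- the first position of `κ` placed in the second summand is a cut
  obtain ⟨a, ha⟩ := hr
  have hex : ∃ j : ℕ, ∃ h : j < κ.1, σ.1 ≤ (f ⟨j, h⟩ : ℕ) := by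
    obtain ⟨b, hb⟩ := hl
    exact ⟨b, b.2, hb⟩
  classical
  obtain ⟨hj, hjf⟩ := Nat.find_spec hex
  have hmin : ∀ i : Fin κ.1, (i : ℕ) < Nat.find hex → (f i : ℕ) < σ.1 := fun i hi => by
    by_contra! hc
    exact Nat.find_min hex hi ⟨i.2, hc⟩
  refine hκ.2 (Nat.find hex) ?_ hj (isCut_of_forall_lt hj.le fun i i' hi hi' => ?_)
  · by_contra! h0
    have h1 : f ⟨Nat.find hex, hj⟩ ≤ f a := f.monotone (Fin.le_def.2 (by simp only; omega))
    rw [Fin.le_def] at h1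
    omega
  · rw [hf, Fin.lt_def]
    have h1 := (directSum_val_lt_iff (f i)).2 (hmin i hi)
    have h2 : f ⟨Nat.find hex, hj⟩ ≤ f i' := f.monotone (Fin.le_def.2 hi')
    have h3 := directSum_val_lt_iff (τ := τ) (f i')
    rw [Fin.le_def] at h2
    omega

end Permutation

/-! ### Counting sum-closed sets by their indecomposable members -/

open Permutation in
/-- A set of permutations containing the empty permutation and, with it, a direct sum exactly if it
contains both summands. -/
structure IsSumClosed (X : Set Permutation) : Prop where
  empty_mem : ⟨0, 1⟩ ∈ X
  directSum_mem : ∀ σ τ : Permutation, directSum σ τ ∈ X ↔ σ ∈ X ∧ τ ∈ X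

/-- The indecomposable members of a set of permutations. -/
def indecomposables (X : Set Permutation) : Set Permutation :=
  {π | π ∈ X ∧ π.IsIndecomposable}

/-- The counting series `∑_{n ≥ 0} |X_n| x ^ n`, which includes the empty permutation. -/
noncomputable def countingSeries (X : Set Permutation) : PowerSeries ℚ :=
  PowerSeries.mk fun n => ((permutationsOfLength X n).ncard : ℚ)

open Classical in
/-- The members of `X` of length `n`, as a finite set of permutations of arbitrary length. -/
noncomputable def slice (X : Set Permutation) (n : ℕ) : Finset Permutation :=
  (Finset.univ.filter fun π => π ∈ permutationsOfLength X n).map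
    ⟨Sigma.mk n, sigma_mk_injective⟩

theorem mem_slice {X : Set Permutation} {n : ℕ} {π : Permutation} :
    π ∈ slice X n ↔ π ∈ X ∧ π.1 = n := by
  simp only [slice, Finset.mem_map, Finset.mem_filter, Finset.mem_univ,
    true_and, Function.Embedding.coeFn_mk]
  constructor
  · rintro ⟨s, hs, rfl⟩
    exact ⟨hs, rfl⟩
  · rintro ⟨h, rfl⟩
    exact ⟨π.2, h, rfl⟩

theorem card_slice (X : Set Permutation) (n : ℕ) :
    (slice X n).card = (permutationsOfLength X n).ncard := by
  classical
  rw [slice, Finset.card_map, ← Set.ncard_coe_finset]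
  congr 1
  ext
  simp

/-- A nonempty member of a sum-closed set splits uniquely into an indecomposable first summand and
a rest. -/
theorem card_slice_eq_sum {X : Set Permutation} (hX : IsSumClosed X) {n : ℕ} (hn : 0 < n) :
    (slice X n).card = ∑ p ∈ Finset.HasAntidiagonal.antidiagonal n,
      (slice (indecomposables X) p.1).card * (slice X p.2).card := by
  classical
  have hS : slice X n = (Finset.HasAntidiagonal.antidiagonal n).biUnion fun p =>
      (slice (indecomposables X) p.1 ×ˢ slice X p.2).image fun q =>
        Permutation.directSum q.1 q.2 := by
    ext π
    simp only [Finset.mem_biUnion, Finset.mem_image, Finset.mem_product, mem_slice,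
      Finset.HasAntidiagonal.mem_antidiagonal, Prod.exists]
    constructor
    · rintro ⟨hπ, rfl⟩
      obtain ⟨σ, τ, hσ, rfl⟩ := Permutation.exists_indecomposable_directSum_eq hn
      have := (hX.directSum_mem σ τ).1 hπ
      exact ⟨σ.1, τ.1, rfl, σ, τ, ⟨⟨⟨this.1, hσ⟩, rfl⟩, this.2, rfl⟩, rfl⟩
    · rintro ⟨a, b, rfl, σ, τ, ⟨⟨hσ, rfl⟩, hτ, rfl⟩, rfl⟩
      exact ⟨(hX.directSum_mem σ τ).2 ⟨hσ.1, hτ⟩, rfl⟩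
  rw [hS, Finset.card_biUnion]
  · refine Finset.sum_congr rfl fun p _ => ?_
    rw [Finset.card_image_of_injOn, Finset.card_product]
    intro q hq q' hq' h
    simp only [Finset.coe_product, Set.mem_prod, Finset.mem_coe, mem_slice] at hq hq'
    have := Permutation.directSum_inj hq.1.1.2 hq'.1.1.2 h
    exact Prod.ext this.1 this.2
  · intro p hp p' hp' hne
    rw [Function.onFun, Finset.disjoint_left]
    intro π h h'
    simp only [Finset.mem_image, Finset.mem_product, mem_slice, Prod.exists] at h h'
    obtain ⟨σ, τ, ⟨⟨hσ, h1⟩, hτ, h2⟩, rfl⟩ := h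
    obtain ⟨σ', τ', ⟨⟨hσ', h1'⟩, hτ', h2'⟩, h⟩ := h'
    obtain ⟨rfl, rfl⟩ := Permutation.directSum_inj hσ'.2 hσ.2 h
    exact hne (Prod.ext (h1.symm.trans h1') (h2.symm.trans h2'))

theorem ncard_permutationsOfLength_zero {X : Set Permutation} (hX : ⟨0, 1⟩ ∈ X) :
    (permutationsOfLength X 0).ncard = 1 := by
  rw [Set.ncard_eq_one]
  refine ⟨1, Set.eq_singleton_iff_unique_mem.2 ⟨hX, fun π _ => Subsingleton.elim _ _⟩⟩

theorem ncard_indecomposables_zero (X : Set Permutation) :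
    (permutationsOfLength (indecomposables X) 0).ncard = 0 := by
  have : permutationsOfLength (indecomposables X) 0 = ∅ :=
    Set.eq_empty_of_forall_notMem fun π hπ => absurd hπ.2.1 (lt_irrefl 0)
  rw [this, Set.ncard_empty]

theorem countingSeries_mul_one_sub {X : Set Permutation} (hX : IsSumClosed X) :
    countingSeries X * (1 - countingSeries (indecomposables X)) = 1 := by
  rw [mul_sub, mul_one, sub_eq_iff_eq_add, mul_comm]
  ext n
  rw [map_add, PowerSeries.coeff_mul]
  simp only [countingSeries, PowerSeries.coeff_mk, PowerSeries.coeff_one]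
  rcases Nat.eq_zero_or_pos n with rfl | hn
  · simp [ncard_permutationsOfLength_zero hX.empty_mem, ncard_indecomposables_zero]
  · rw [if_neg hn.ne', zero_add, ← card_slice, card_slice_eq_sum hX hn]
    push_cast
    simp only [card_slice]

theorem generatingFunction_eq {X : Set Permutation} (hX : IsSumClosed X) :
    generatingFunction X = countingSeries X - 1 := by
  ext n
  rw [map_sub]
  simp only [generatingFunction, countingSeries, PowerSeries.coeff_mk, PowerSeries.coeff_one]
  split_ifs with h
  · rw [h, ncard_permutationsOfLength_zero hX.empty_mem]; simp
  · simp

/-- Changing finitely many of the numbers of indecomposables preserves rationality. -/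
theorem isRationalSeries_of_eventually_eq {X Y : Set Permutation} (hX : IsSumClosed X)
    (hY : IsSumClosed Y) (hr : IsRationalSeries (countingSeries X)) (n₀ : ℕ)
    (h : ∀ n, n₀ ≤ n → (permutationsOfLength (indecomposables Y) n).ncard =
      (permutationsOfLength (indecomposables X) n).ncard) :
    IsRationalSeries (generatingFunction Y) := by
  obtain ⟨p, q, hq, hpq⟩ := hr
  -- with `F = p / q`, the identity `F (1 - I) = 1` gives `1 - I = q / p`; so if `I' = I + r`, then
  -- `F' = 1 / (1 - I') = p / (q - r p)`
  let r : Polynomial ℚ := PowerSeries.trunc n₀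
    (countingSeries (indecomposables Y) - countingSeries (indecomposables X))
  have hrs : (r : PowerSeries ℚ) =
      countingSeries (indecomposables Y) - countingSeries (indecomposables X) := by
    ext n
    rw [Polynomial.coeff_coe, PowerSeries.coeff_trunc]
    split_ifs with hn
    · rfl
    · rw [map_sub]
      simp only [countingSeries, PowerSeries.coeff_mk, h n (not_lt.1 hn), sub_self]
  have hr0 : r.coeff 0 = 0 := by
    rw [← Polynomial.coeff_coe, hrs, map_sub]
    simp [countingSeries, ncard_indecomposables_zero]
  have eX := countingSeries_mul_one_sub hX
  have eY := countingSeries_mul_one_sub hY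
  refine ⟨p - (q - r * p), q - r * p, ?_, ?_⟩
  · rw [Polynomial.coeff_sub, Polynomial.mul_coeff_zero, hr0, zero_mul, sub_zero]
    exact hq
  · rw [generatingFunction_eq hY, Polynomial.coe_sub]
    simp only [Polynomial.coe_sub, Polynomial.coe_mul, hrs, ← hpq]
    linear_combination (countingSeries X * q) * eY - (q * (countingSeries Y)) * eX

/-! ### Permutations of bounded displacement -/

/-- The entries to the right of and below the entry at position `p`. -/
def lowerRight {n : ℕ} (s : Equiv.Perm (Fin n)) (p : Fin n) : Finset (Fin n) :=
  Finset.univ.filter fun i => p < i ∧ s i < s p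

/-- The entries to the left of and above the entry at position `p`. -/
def upperLeft {n : ℕ} (s : Equiv.Perm (Fin n)) (p : Fin n) : Finset (Fin n) :=
  Finset.univ.filter fun i => i < p ∧ s p < s i

theorem mem_lowerRight {n : ℕ} {s : Equiv.Perm (Fin n)} {p i : Fin n} :
    i ∈ lowerRight s p ↔ p < i ∧ s i < s p := by
  simp [lowerRight]

theorem mem_upperLeft {n : ℕ} {s : Equiv.Perm (Fin n)} {p i : Fin n} :
    i ∈ upperLeft s p ↔ i < p ∧ s p < s i := by
  simp [upperLeft]

theorem card_upperLeft {n : ℕ} (s : Equiv.Perm (Fin n)) (p : Fin n) :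
    (upperLeft s p).card = (lowerRight s.symm (s p)).card := by
  rw [← Finset.card_map s.toEmbedding]
  congr 1
  ext i
  rw [Finset.mem_map_equiv, mem_upperLeft, mem_lowerRight]
  simp [and_comm]

theorem le_add_card_lowerRight {n : ℕ} (s : Equiv.Perm (Fin n)) (p : Fin n) :
    (s p : ℕ) ≤ p + (lowerRight s p).card := by
  have hsub : (Finset.Iio (s p)).map s.symm.toEmbedding ⊆ Finset.Iio p ∪ lowerRight s p := by
    intro i hi
    rw [Finset.mem_map_equiv, Equiv.symm_symm, Finset.mem_Iio] at hi
    rw [Finset.mem_union, Finset.mem_Iio, mem_lowerRight]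
    rcases lt_trichotomy i p with h | h | h
    · exact .inl h
    · exact absurd hi (h ▸ lt_irrefl _)
    · exact .inr ⟨h, hi⟩
  have h1 := (Finset.card_le_card hsub).trans (Finset.card_union_le _ _)
  rwa [Finset.card_map, Fin.card_Iio, Fin.card_Iio] at h1

theorem le_add_card_upperLeft {n : ℕ} (s : Equiv.Perm (Fin n)) (p : Fin n) :
    (p : ℕ) ≤ s p + (upperLeft s p).card := by
  rw [card_upperLeft]
  simpa using le_add_card_lowerRight s.symm (s p)

theorem card_lowerRight_le_iff {n k : ℕ} (s : Equiv.Perm (Fin n)) :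
    (∀ p, (lowerRight s p).card ≤ k) ↔ ∀ p, (s p : ℕ) ≤ p + k := by
  constructor
  · exact fun h p => (le_add_card_lowerRight s p).trans (Nat.add_le_add_left (h p) _)
  · intro h p
    -- the entries counted and those up to position `p` all have values at most `p + k`
    have hdisj : Disjoint (lowerRight s p) (Finset.Iic p) := by
      rw [Finset.disjoint_left]
      exact fun i hi hi' => absurd (mem_lowerRight.1 hi).1 (not_lt.2 (Finset.mem_Iic.1 hi'))
    have hcard : (lowerRight s p ∪ Finset.Iic p).card ≤ (Finset.range (p + k + 1)).card := by
      refine Finset.card_le_card_of_injOn (fun i => (s i : ℕ)) (fun i hi => ?_)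
        (fun i _ j _ hij => s.injective (Fin.ext hij))
      rw [Finset.mem_coe, Finset.mem_union, mem_lowerRight, Finset.mem_Iic] at hi
      simp only [Finset.coe_range, Set.mem_Iio]
      have hp := h p
      have hi' := h i
      rcases hi with ⟨_, hi⟩ | hi
      · rw [Fin.lt_def] at hi
        omega
      · rw [Fin.le_def] at hi
        omega
    rw [Finset.card_union_of_disjoint hdisj, Fin.card_Iic, Finset.card_range] at hcard
    omega

theorem card_upperLeft_le_iff {n k : ℕ} (s : Equiv.Perm (Fin n)) :
    (∀ p, (upperLeft s p).card ≤ k) ↔ ∀ p : Fin n, (p : ℕ) ≤ s p + k := by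
  simp only [card_upperLeft]
  rw [s.forall_congr_left (p := fun p => (lowerRight s.symm (s p)).card ≤ k),
    s.forall_congr_left (p := fun p : Fin n => (p : ℕ) ≤ s p + k)]
  simp only [Equiv.apply_symm_apply]
  exact card_lowerRight_le_iff s.symm

/-- The class of the permutations `π` with `|π i - i| ≤ k` for all `i`. -/
def bandClass (k : ℕ) : Set Permutation :=
  {π | π.2 ∈ bandPermutations k π.1}

theorem mem_bandClass {k : ℕ} {π : Permutation} :
    π ∈ bandClass k ↔ ∀ i, (π.2 i : ℕ) ≤ i + k ∧ (i : ℕ) ≤ π.2 i + k := Iff.rfl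

/-- Bounded displacement means that every entry is in few inversions on either side. -/
theorem mem_bandClass_iff_card {k : ℕ} {π : Permutation} :
    π ∈ bandClass k ↔ ∀ p, (lowerRight π.2 p).card ≤ k ∧ (upperLeft π.2 p).card ≤ k := by
  rw [mem_bandClass, forall_and, forall_and, card_lowerRight_le_iff, card_upperLeft_le_iff]

theorem isPermutationClass_bandClass (k : ℕ) : IsPermutationClass (bandClass k) := by
  rintro σ π hπ ⟨f, hf⟩
  rw [mem_bandClass_iff_card] at hπ ⊢
  refine fun p => ⟨le_trans ?_ (hπ (f p)).1, le_trans ?_ (hπ (f p)).2⟩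
  · refine Finset.card_le_card_of_injOn f (fun i hi => ?_) f.injective.injOn
    rw [Finset.mem_coe, mem_lowerRight] at hi ⊢
    exact ⟨f.strictMono hi.1, (hf _ _).1 hi.2⟩
  · refine Finset.card_le_card_of_injOn f (fun i hi => ?_) f.injective.injOn
    rw [Finset.mem_coe, mem_upperLeft] at hi ⊢
    exact ⟨f.strictMono hi.1, (hf _ _).1 hi.2⟩

theorem isSumClosed_bandClass (k : ℕ) : IsSumClosed (bandClass k) := by
  refine ⟨fun i => i.elim0, fun σ τ => ⟨fun h => ⟨?_, ?_⟩, fun h i => ?_⟩⟩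
  · exact isPermutationClass_bandClass k _ _ h (Permutation.isContainedIn_directSum_left σ τ)
  · exact isPermutationClass_bandClass k _ _ h (Permutation.isContainedIn_directSum_right σ τ)
  · change Fin (σ.1 + τ.1) at i
    refine Fin.addCases (fun i => ?_) (fun i => ?_) i
    · rw [Permutation.directSum_castAdd]
      exact h.1 i
    · rw [Permutation.directSum_natAdd]
      have := mem_bandClass.1 h.2 i
      simp only [Fin.val_natAdd]
      omega

/-! ### Saturated permutations -/

/-- The inversion graph of an indecomposable permutation is connected. -/
theorem Permutation.IsIndecomposable.iff_of_forall_inversion {σ : Permutation}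
    (hσ : σ.IsIndecomposable) (P : Fin σ.1 → Prop)
    (h : ∀ x y, x < y → σ.2 y < σ.2 x → (P x ↔ P y)) (x y : Fin σ.1) : P x ↔ P y := by
  classical
  suffices H : ∀ x, P x ↔ P ⟨0, hσ.1⟩ from (H x).trans (H y).symm
  by_contra! hne
  have hlt : ∀ x y, x < y → ¬ (P x ↔ P y) → σ.2 x < σ.2 y := fun x y hxy hP =>
    lt_of_le_of_ne (not_lt.1 fun h' => hP (h x y hxy h')) (σ.2.injective.ne hxy.ne)
  have hex : ∃ j : ℕ, ∃ hj : j < σ.1, ¬ (P ⟨j, hj⟩ ↔ P ⟨0, hσ.1⟩) := by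
    obtain ⟨x, hx⟩ := hne
    exact ⟨x, x.2, fun h' => by tauto⟩
  obtain ⟨hj, hjP⟩ := Nat.find_spec hex
  have hmin : ∀ i : Fin σ.1, (i : ℕ) < Nat.find hex → (P i ↔ P ⟨0, hσ.1⟩) := fun i hi => by
    by_contra hc
    exact Nat.find_min hex hi ⟨i.2, hc⟩
  -- everything from the first position `j` unrelated to position `0` on lies above what precedes
  refine hσ.2 (Nat.find hex) (Nat.pos_of_ne_zero fun h0 => ?_) hj
    (isCut_of_forall_lt hj.le fun i i' hi hi' => ?_)
  · simp only [h0, not_true_eq_false] at hjP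
  · have hij := hlt i ⟨_, hj⟩ hi (fun hP => hjP (hP.symm.trans (hmin i hi)))
    by_cases hi'P : P i' ↔ P ⟨0, hσ.1⟩
    · have hne' : (⟨_, hj⟩ : Fin σ.1) ≠ i' := fun e => hjP (e ▸ hi'P)
      exact hij.trans (hlt _ i' (lt_of_le_of_ne hi' hne') fun hP => hjP (hP.trans hi'P))
    · exact hlt i i' (Nat.lt_of_lt_of_le hi hi') fun hP => hi'P (hP.symm.trans (hmin i hi))

/-- An indecomposable permutation of displacement at most `k` in which every entry lies weakly to
the right of and below one displaced by `k` upwards, and weakly to the left of and above one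
displaced by `k` downwards. -/
structure IsSaturated (k : ℕ) (a : Permutation) : Prop where
  isIndecomposable : a.IsIndecomposable
  mem_bandClass : a ∈ bandClass k
  exists_up : ∀ p, ∃ u ≤ p, a.2 p ≤ a.2 u ∧ (a.2 u : ℕ) = u + k
  exists_down : ∀ p, ∃ v ≥ p, a.2 v ≤ a.2 p ∧ (a.2 v : ℕ) + k = v

theorem Permutation.eq_of_isContainedIn_of_length_le {σ π : Permutation} (h : σ.IsContainedIn π)
    (hl : π.1 ≤ σ.1) : σ = π := by
  obtain ⟨n, s⟩ := σ
  obtain ⟨m, t⟩ := π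
  obtain ⟨f, hf⟩ := h
  simp only at hl f hf
  have hle : n ≤ m := by simpa using Fintype.card_le_of_embedding f.toEmbedding
  obtain rfl : n = m := le_antisymm hle hl
  have hfid : (f : Fin n → Fin n) = id := by
    refine (f.strictMono.range_inj strictMono_id).1 ?_
    rw [Set.range_id, (Finite.injective_iff_surjective.1 f.injective).range_eq]
  have hst : (s : Fin n → Fin n) ∘ t.symm = id := by
    refine (StrictMono.range_inj (fun i j hij => ?_) strictMono_id).1 ?_
    · have := (hf (t.symm i) (t.symm j)).2
      simp only [hfid, id, Equiv.apply_symm_apply] at this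
      exact this hij
    · rw [Set.range_id, (s.surjective.comp t.symm.surjective).range_eq]
  congr 1
  ext i
  have := congrFun hst (t i)
  simp only [Function.comp_apply, Equiv.symm_apply_apply, id] at this
  rw [this]

/-- A saturated permutation is maximal among the indecomposable permutations of displacement at
most `k`: by connectedness, an additional entry would be in an inversion with one of its entries,
and then in one with an entry that already is in `k` inversions of that kind. -/
theorem IsSaturated.eq_of_isContainedIn {k : ℕ} {a σ : Permutation} (ha : IsSaturated k a)
    (hσ : σ.IsIndecomposable) (hσk : σ ∈ bandClass k) (h : a.IsContainedIn σ) : a = σ := by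
  refine Permutation.eq_of_isContainedIn_of_length_le h ?_
  obtain ⟨f, hf⟩ := h
  suffices hsurj : Function.Surjective f by
    simpa using Fintype.card_le_of_surjective f hsurj
  rw [mem_bandClass_iff_card] at hσk
  have hright : ∀ p x, f p < x → σ.2 x < σ.2 (f p) → x ∈ Set.range f := by
    intro p x hx hσx
    by_contra hxf
    obtain ⟨u, hup, hau, huk⟩ := ha.exists_up p
    have h1 : (insert x ((lowerRight a.2 u).map f.toEmbedding)).card ≤
        (lowerRight σ.2 (f u)).card := by
      refine Finset.card_le_card fun y hy => ?_
      rw [mem_lowerRight]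
      rcases Finset.mem_insert.1 hy with rfl | hy
      · refine ⟨(f.monotone hup).trans_lt hx, hσx.trans_le (not_lt.1 fun h' => ?_)⟩
        exact absurd ((hf _ _).2 h') (not_lt.2 hau)
      · obtain ⟨i, hi, rfl⟩ := Finset.mem_map.1 hy
        rw [mem_lowerRight] at hi
        exact ⟨f.strictMono hi.1, (hf _ _).1 hi.2⟩
    rw [Finset.card_insert_of_notMem, Finset.card_map] at h1
    · have h2 := le_add_card_lowerRight a.2 u
      have h3 := (hσk (f u)).1
      omega
    · intro hx'
      obtain ⟨i, -, rfl⟩ := Finset.mem_map.1 hx'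
      exact hxf ⟨i, rfl⟩
  have hleft : ∀ p x, x < f p → σ.2 (f p) < σ.2 x → x ∈ Set.range f := by
    intro p x hx hσx
    by_contra hxf
    obtain ⟨v, hvp, hav, hvk⟩ := ha.exists_down p
    have h1 : (insert x ((upperLeft a.2 v).map f.toEmbedding)).card ≤
        (upperLeft σ.2 (f v)).card := by
      refine Finset.card_le_card fun y hy => ?_
      rw [mem_upperLeft]
      rcases Finset.mem_insert.1 hy with rfl | hy
      · refine ⟨hx.trans_le (f.monotone hvp), (not_lt.1 fun h' => ?_ : _ ≤ _).trans_lt hσx⟩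
        exact absurd ((hf _ _).2 h') (not_lt.2 hav)
      · obtain ⟨i, hi, rfl⟩ := Finset.mem_map.1 hy
        rw [mem_upperLeft] at hi
        exact ⟨f.strictMono hi.1, (hf _ _).1 hi.2⟩
    rw [Finset.card_insert_of_notMem, Finset.card_map] at h1
    · have h2 := le_add_card_upperLeft a.2 v
      have h3 := (hσk (f v)).2
      omega
    · intro hx'
      obtain ⟨i, -, rfl⟩ := Finset.mem_map.1 hx'
      exact hxf ⟨i, rfl⟩
  intro y
  refine (hσ.iff_of_forall_inversion (· ∈ Set.range f) (fun x y hxy hσxy => ?_)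
    (f ⟨0, ha.isIndecomposable.1⟩) y).1 ⟨_, rfl⟩
  constructor
  · rintro ⟨p, rfl⟩
    exact hright p y hxy hσxy
  · rintro ⟨p, rfl⟩
    exact hleft p x hxy hσxy

/-! ### Abundance of saturated permutations -/

/-- The positions `u` whose entries are swapped with those at `u + (4 * L + 1)` to form a saturated
permutation of length `n`: the position `0`, and from the last possible position on leftwards every
`L`-th position, except that the partner `4 * L + 1` of the position `0` is left out. As `4 * L + 1`
is no multiple of `L`, no hub is the partner of another. -/
def IsHub (L n u : ℕ) : Prop :=
  u + (4 * L + 1) < n ∧ (u = 0 ∨ (u ≠ 4 * L + 1 ∧ ∃ c, u + (4 * L + 1) + 1 + L * c = n))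

namespace IsHub

variable {L n : ℕ}

theorem not_add {u : ℕ} (hL : 2 ≤ L) (h : IsHub L n u) : ¬ IsHub L n (u + (4 * L + 1)) := by
  rintro ⟨h1, h2⟩
  rcases h2 with h2 | ⟨h2, c', hc'⟩
  · omega
  rcases h.2 with rfl | ⟨-, c, hc⟩
  · omega
  have h3 : L * c = L * (4 + c') + 1 := by rw [mul_add]; omega
  have h4 : L ∣ 1 := (Nat.dvd_add_right (Dvd.intro _ rfl : L ∣ L * (4 + c'))).1 ⟨c, h3.symm⟩
  have := Nat.le_of_dvd one_pos h4
  omega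

theorem zero (hn : 20 * L < n) (hL : 2 ≤ L) : IsHub L n 0 := ⟨by omega, .inl rfl⟩

theorem last (hn : 20 * L < n) (hL : 2 ≤ L) : IsHub L n (n - (4 * L + 2)) :=
  ⟨by omega, .inr ⟨by omega, 0, by omega⟩⟩

theorem exists_le (hn : 20 * L < n) (hL : 2 ≤ L) {q : ℕ} (hq : q + (4 * L + 1) < n) :
    ∃ u, IsHub L n u ∧ u ≤ q ∧ q ≤ u + 2 * L := by
  have hd := Nat.div_add_mod (n - (4 * L + 2) - q) L
  have hr := Nat.mod_lt (n - (4 * L + 2) - q) (show 0 < L by omega)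
  set c := (n - (4 * L + 2) - q) / L
  set r := (n - (4 * L + 2) - q) % L
  have e1 : L * (c + 1) = L * c + L := by ring
  have e2 : L * (c + 2) = L * c + 2 * L := by ring
  by_cases h0 : q + r < L
  · exact ⟨0, zero hn hL, by omega, by omega⟩
  by_cases hk : q + r - L = 4 * L + 1
  · exact ⟨q + r - 2 * L, ⟨by omega, .inr ⟨by omega, c + 2, by omega⟩⟩, by omega, by omega⟩
  · exact ⟨q + r - L, ⟨by omega, .inr ⟨hk, c + 1, by omega⟩⟩, by omega, by omega⟩

theorem exists_ge (hn : 20 * L < n) (hL : 2 ≤ L) {q : ℕ} (hq : q + (4 * L + 1) < n) :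
    ∃ u, IsHub L n u ∧ q ≤ u ∧ u ≤ q + 2 * L := by
  have hd := Nat.div_add_mod (n - (4 * L + 2) - q) L
  have hr := Nat.mod_lt (n - (4 * L + 2) - q) (show 0 < L by omega)
  set c := (n - (4 * L + 2) - q) / L
  set r := (n - (4 * L + 2) - q) % L
  by_cases hk : q + r = 4 * L + 1
  · rcases Nat.eq_zero_or_pos c with hc | hc
    · rw [hc] at hd
      omega
    · have e1 : L * c = L * (c - 1) + L := by
        obtain ⟨c', hc'⟩ := Nat.exists_eq_add_of_lt hc
        rw [hc', zero_add, Nat.add_sub_cancel]; ring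
      exact ⟨q + r + L, ⟨by omega, .inr ⟨by omega, c - 1, by omega⟩⟩, by omega, by omega⟩
  · exact ⟨q + r, ⟨by omega, .inr ⟨hk, c, by omega⟩⟩, by omega, by omega⟩

end IsHub

open Classical in
/-- Swap the hubs with their partners. -/
noncomputable def hubSwapFun (L n : ℕ) (i : Fin n) : Fin n :=
  if h : IsHub L n i then ⟨i + (4 * L + 1), h.1⟩
  else if 4 * L + 1 ≤ (i : ℕ) ∧ IsHub L n (i - (4 * L + 1)) then ⟨i - (4 * L + 1), by omega⟩ else i

theorem hubSwapFun_of_isHub {L n : ℕ} {i : Fin n} (h : IsHub L n i) :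
    (hubSwapFun L n i : ℕ) = i + (4 * L + 1) := by
  rw [hubSwapFun, dif_pos h]

theorem hubSwapFun_of_partner {L n : ℕ} (hL : 2 ≤ L) {i : Fin n} (h1 : 4 * L + 1 ≤ (i : ℕ))
    (h2 : IsHub L n (i - (4 * L + 1))) : (hubSwapFun L n i : ℕ) = i - (4 * L + 1) := by
  have := h2.not_add hL
  rw [Nat.sub_add_cancel h1] at this
  rw [hubSwapFun, dif_neg this, if_pos ⟨h1, h2⟩]

/-- The hubs and their partners. -/
def IsHubOrPartner (L n i : ℕ) : Prop :=
  IsHub L n i ∨ (4 * L + 1 ≤ i ∧ IsHub L n (i - (4 * L + 1)))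

theorem hubSwapFun_of_not {L n : ℕ} {i : Fin n} (h : ¬ IsHubOrPartner L n i) :
    hubSwapFun L n i = i := by
  rw [IsHubOrPartner, not_or] at h
  rw [hubSwapFun, dif_neg h.1, if_neg h.2]

theorem hubSwapFun_involutive {L n : ℕ} (hL : 2 ≤ L) :
    Function.Involutive (hubSwapFun L n) := by
  intro i
  by_cases h : IsHubOrPartner L n i
  · rcases h with h | ⟨h1, h2⟩
    · have e := hubSwapFun_of_isHub h
      refine Fin.ext ((hubSwapFun_of_partner hL (by omega) ?_).trans (by omega))
      rwa [e, Nat.add_sub_cancel]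
    · have e := hubSwapFun_of_partner hL h1 h2
      refine Fin.ext ((hubSwapFun_of_isHub ?_).trans (by omega))
      rwa [e]
  · rw [hubSwapFun_of_not h, hubSwapFun_of_not h]

open Classical in
/-- A permutation preserving this label fixes the hubs and their partners and moves every other
entry within its interval `[j * L, (j + 1) * L)`. -/
noncomputable def hubLabel (L n : ℕ) (i : Fin n) : Fin n ⊕ Fin n :=
  if IsHubOrPartner L n i then .inl i else .inr ⟨i / L, (Nat.div_le_self _ _).trans_lt i.2⟩

theorem apply_eq_of_isHubOrPartner {L n : ℕ} {τ : Equiv.Perm (Fin n)}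
    (hτ : hubLabel L n ∘ τ = hubLabel L n) {i : Fin n} (h : IsHubOrPartner L n i) : τ i = i := by
  have := congrFun hτ i
  simp only [Function.comp_apply, hubLabel, if_pos h] at this
  split_ifs at this
  exact Sum.inl_injective this

theorem apply_of_not_isHubOrPartner {L n : ℕ} {τ : Equiv.Perm (Fin n)}
    (hτ : hubLabel L n ∘ τ = hubLabel L n) {i : Fin n} (h : ¬ IsHubOrPartner L n i) :
    ¬ IsHubOrPartner L n (τ i) ∧ (τ i : ℕ) / L = i / L := by
  have := congrFun hτ i
  simp only [Function.comp_apply, hubLabel, if_neg h] at this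
  split_ifs at this with h'
  exact ⟨h', congrArg Fin.val (Sum.inr_injective this)⟩

/-- Hubs leave gaps of at most `2 * L` and the other entries are displaced by less than `L`, so the
displacement `4 * L + 1` of a hub and of its partner suffices to cover the entries in between. -/
theorem isSaturated_trans_hubSwap {L n : ℕ} (hn : 20 * L < n) (hL : 2 ≤ L)
    {τ : Equiv.Perm (Fin n)} (hτ : hubLabel L n ∘ τ = hubLabel L n) :
    IsSaturated (4 * L + 1) ⟨n, τ.trans (hubSwapFun_involutive hL).toPerm⟩ := by
  set a : Equiv.Perm (Fin n) := τ.trans (hubSwapFun_involutive hL).toPerm with ha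
  have haval : ∀ i, a i = hubSwapFun L n (τ i) := fun i => rfl
  have hhub : ∀ i : Fin n, IsHub L n i → (a i : ℕ) = i + (4 * L + 1) := fun i h => by
    rw [haval, apply_eq_of_isHubOrPartner hτ (.inl h), hubSwapFun_of_isHub h]
  have hpart : ∀ i : Fin n, 4 * L + 1 ≤ (i : ℕ) → IsHub L n (i - (4 * L + 1)) →
      (a i : ℕ) = i - (4 * L + 1) := fun i h1 h2 => by
    rw [haval, apply_eq_of_isHubOrPartner hτ (.inr ⟨h1, h2⟩), hubSwapFun_of_partner hL h1 h2]
  have hmid : ∀ i : Fin n, ¬ IsHubOrPartner L n i → (a i : ℕ) < i + L ∧ (i : ℕ) < a i + L := by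
    intro i h
    obtain ⟨h1, h2⟩ := apply_of_not_isHubOrPartner hτ h
    rw [haval, hubSwapFun_of_not h1]
    have e1 := Nat.div_add_mod (τ i) L
    have e2 := Nat.div_add_mod i L
    have l1 := Nat.mod_lt (τ i) (show L > 0 by omega)
    have l2 := Nat.mod_lt i (show L > 0 by omega)
    rw [h2] at e1
    omega
  have hpart' : ∀ u, ∀ h : IsHub L n u, (a ⟨u + (4 * L + 1), h.1⟩ : ℕ) = u := fun u h => by
    rw [hpart ⟨u + (4 * L + 1), h.1⟩ (by simp) (by simpa using h)]
    simp
  refine ⟨⟨by simp only; omega, fun j hj hjn hcut => ?_⟩, fun i => ?_, fun p => ?_, fun p => ?_⟩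
  · replace hcut : ∀ i : Fin n, (a i : ℕ) < j ↔ (i : ℕ) < j := hcut
    simp only at hjn
    by_cases hjk : j ≤ 4 * L + 1
    · have h1 := (hcut ⟨0, by omega⟩).2 hj
      rw [hhub ⟨0, by omega⟩ (IsHub.zero hn hL)] at h1
      simp only at h1
      omega
    · obtain ⟨u, hu, h1, h2⟩ := IsHub.exists_ge hn hL (q := j - (4 * L + 1)) (by omega)
      have h3 := (hcut ⟨u, by omega⟩).2 (by simp only; omega)
      rw [hhub ⟨u, by omega⟩ hu] at h3
      simp only at h3
      omega
  · change (a i : ℕ) ≤ i + _ ∧ (i : ℕ) ≤ a i + _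
    by_cases h : IsHubOrPartner L n i
    · rcases h with h | ⟨h1, h2⟩
      · have := hhub i h; omega
      · have := hpart i h1 h2; omega
    · have := hmid i h; omega
  · change Fin n at p
    change ∃ u ≤ p, a p ≤ a u ∧ (a u : ℕ) = u + (4 * L + 1)
    by_cases h : IsHubOrPartner L n p
    · rcases h with h | ⟨h1, h2⟩
      · exact ⟨p, le_rfl, le_rfl, hhub p h⟩
      · have e1 := hpart p h1 h2
        have e2 := hhub ⟨p - (4 * L + 1), by omega⟩ h2
        refine ⟨⟨p - (4 * L + 1), by omega⟩, Fin.le_def.2 (by simp), Fin.le_def.2 ?_, e2⟩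
        simp only at e2
        omega
    · have hp := hmid p h
      by_cases hq : (p : ℕ) + (4 * L + 1) < n
      · obtain ⟨u, hu, h1, h2⟩ := IsHub.exists_le hn hL hq
        have e2 := hhub ⟨u, by omega⟩ hu
        refine ⟨⟨u, by omega⟩, Fin.le_def.2 h1, Fin.le_def.2 ?_, e2⟩
        simp only at e2
        omega
      · have e2 := hhub ⟨n - (4 * L + 2), by omega⟩ (IsHub.last hn hL)
        refine ⟨⟨n - (4 * L + 2), by omega⟩, Fin.le_def.2 (by simp only; omega),
          Fin.le_def.2 ?_, e2⟩
        have := (a p).2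
        simp only at e2
        omega
  · change Fin n at p
    change ∃ v ≥ p, a v ≤ a p ∧ (a v : ℕ) + (4 * L + 1) = v
    by_cases h : IsHubOrPartner L n p
    · rcases h with h | ⟨h1, h2⟩
      · have e1 := hhub p h
        have e2 := hpart' p h
        refine ⟨⟨p + (4 * L + 1), h.1⟩, Fin.le_def.2 (by simp only; omega), Fin.le_def.2 ?_, ?_⟩
        · omega
        · rw [e2]
      · exact ⟨p, le_rfl, le_rfl, by rw [hpart p h1 h2]; omega⟩
    · have hp := hmid p h
      by_cases hq : (p : ℕ) ≤ 4 * L + 1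
      · have e2 := hpart' 0 (IsHub.zero hn hL)
        refine ⟨⟨0 + (4 * L + 1), by omega⟩, Fin.le_def.2 (by simp only; omega),
          Fin.le_def.2 ?_, ?_⟩
        · omega
        · rw [e2]
      · obtain ⟨u, hu, h1, h2⟩ := IsHub.exists_ge hn hL (q := p - (4 * L + 1)) (by omega)
        have e2 := hpart' u hu
        refine ⟨⟨u + (4 * L + 1), hu.1⟩, Fin.le_def.2 (by simp only; omega), Fin.le_def.2 ?_, ?_⟩
        · omega
        · rw [e2]

/-- Each interval of length `L` has at most four hubs or partners: possibly `0` and `4 * L + 1`, and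
apart from these one hub and one partner, which are determined by their residues modulo `L`. -/
theorem le_card_hubLabel_fiber {L n : ℕ} (hL : 0 < L) {j : ℕ} (hj : j < n / L) (hjn : j < n) :
    L - 4 ≤ Fintype.card {i : Fin n // hubLabel L n i = .inr ⟨j, hjn⟩} := by
  classical
  have hjL : (j + 1) * L ≤ n := (Nat.le_div_iff_mul_le hL).1 hj
  let B : Finset ℕ := Finset.Ico (j * L) (j * L + L) \
    {0, 4 * L + 1, L * j + (n - (4 * L + 2)) % L, L * j + (n - 1) % L}
  have hB : L - 4 ≤ B.card := by
    have h1 := Finset.le_card_sdiff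
      ({0, 4 * L + 1, L * j + (n - (4 * L + 2)) % L, L * j + (n - 1) % L} : Finset ℕ)
      (Finset.Ico (j * L) (j * L + L))
    have h2 : ({0, 4 * L + 1, L * j + (n - (4 * L + 2)) % L, L * j + (n - 1) % L} :
      Finset ℕ).card ≤ 4 := Finset.card_le_four
    rw [Nat.card_Ico] at h1
    change _ ≤ B.card at h1
    omega
  have hmem : ∀ x ∈ B, ∃ hx : x < n, hubLabel L n ⟨x, hx⟩ = .inr ⟨j, hjn⟩ := by
    intro x hx
    simp only [B, Finset.mem_sdiff, Finset.mem_Ico, Finset.mem_insert, Finset.mem_singleton,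
      not_or] at hx
    obtain ⟨⟨h1, h2⟩, h3, h4, h5, h6⟩ := hx
    have hxn : x < n := by rw [add_mul, one_mul] at hjL; omega
    have hdiv : x / L = j := by rw [Nat.div_eq_iff hL]; omega
    have hmod := Nat.div_add_mod x L
    rw [hdiv] at hmod
    refine ⟨hxn, ?_⟩
    have hnot : ¬ IsHubOrPartner L n x := by
      rintro (⟨-, h | ⟨-, c, hc⟩⟩ | ⟨h7, -, h | ⟨-, c, hc⟩⟩)
      · exact h3 h
      · apply h5
        rw [show n - (4 * L + 2) = x + L * c by omega, Nat.add_mul_mod_self_left]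
        exact hmod.symm
      · omega
      · apply h6
        rw [show n - 1 = x + L * c by omega, Nat.add_mul_mod_self_left]
        exact hmod.symm
    rw [hubLabel, if_neg hnot]
    simp only [hdiv]
  rw [Fintype.card_subtype]
  refine hB.trans (Finset.card_le_card_of_surjOn (fun i : Fin n => (i : ℕ)) fun x hx => ?_)
  obtain ⟨hxn, hx'⟩ := hmem x hx
  exact ⟨⟨x, hxn⟩, by simpa using hx', rfl⟩

theorem exists_pow_le_factorial (K : ℕ) : ∃ L, 4 ≤ L ∧ K ^ (2 * L) ≤ (L - 4).factorial := by
  rcases Nat.eq_zero_or_pos K with rfl | hK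
  · exact ⟨4, le_rfl, by simp⟩
  have h := (FloorSemiring.tendsto_pow_div_factorial_atTop ((K : ℝ) ^ 2)).eventually
    (gt_mem_nhds (show (0 : ℝ) < 1 / (K : ℝ) ^ 8 by positivity))
  obtain ⟨m, hm⟩ := h.exists
  refine ⟨m + 4, by omega, ?_⟩
  rw [div_lt_div_iff₀ (by positivity) (by positivity), one_mul, ← pow_mul, ← pow_add] at hm
  have : (K : ℝ) ^ (2 * (m + 4)) ≤ m.factorial := by
    rw [show 2 * (m + 4) = 2 * m + 8 by ring]
    exact hm.le
  rw [Nat.add_sub_cancel]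
  exact_mod_cast this

/-- For large `k`, the saturated permutations outgrow any given exponential: between the hubs, the
entries of each interval of length `L` may be permuted freely. -/
theorem exists_pow_le_ncard_isSaturated (K : ℕ) : ∃ k n₀ : ℕ, ∀ n, n₀ ≤ n →
    K ^ n ≤ {a : Equiv.Perm (Fin n) | IsSaturated k ⟨n, a⟩}.ncard := by
  classical
  rcases Nat.eq_zero_or_pos K with rfl | hK
  · exact ⟨0, 1, fun n hn => by rw [Nat.zero_pow hn]; exact Nat.zero_le _⟩
  obtain ⟨L, hL4, hL⟩ := exists_pow_le_factorial K
  refine ⟨4 * L + 1, 20 * L + 1, fun n hn => ?_⟩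
  have hL2 : 2 ≤ L := by omega
  have hL0 : 0 < L := by omega
  have hcard : {τ : Equiv.Perm (Fin n) | hubLabel L n ∘ τ = hubLabel L n}.ncard =
      ∏ i, (Fintype.card {a // hubLabel L n a = i}).factorial := by
    rw [← DomMulAct.stabilizer_card (hubLabel L n), ← Nat.card_eq_fintype_card]
    rfl
  have hle : n / L ≤ n := Nat.div_le_self _ _
  have h1 : K ^ n ≤ (L - 4).factorial ^ (n / L) := by
    calc K ^ n ≤ K ^ (2 * L * (n / L)) := by
          refine Nat.pow_le_pow_right hK ?_
          have e := Nat.div_add_mod n L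
          have l := Nat.mod_lt n hL0
          have : 1 ≤ n / L := (Nat.le_div_iff_mul_le hL0).2 (by omega)
          nlinarith
      _ = (K ^ (2 * L)) ^ (n / L) := pow_mul _ _ _
      _ ≤ _ := Nat.pow_le_pow_left hL _
  let T : Finset (Fin n ⊕ Fin n) :=
    Finset.univ.map ((Fin.castLEEmb hle).trans Function.Embedding.inr)
  have hT : T.card = n / L := by simp [T]
  have h2 : (L - 4).factorial ^ (n / L) ≤
      ∏ i ∈ T, (Fintype.card {a // hubLabel L n a = i}).factorial := by
    rw [← hT]
    refine Finset.pow_card_le_prod _ _ _ fun i hi => ?_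
    obtain ⟨j, -, rfl⟩ := Finset.mem_map.1 hi
    exact Nat.factorial_le (le_card_hubLabel_fiber hL0 j.2 (j.2.trans_le hle))
  have h3 : ∏ i ∈ T, (Fintype.card {a // hubLabel L n a = i}).factorial ≤
      ∏ i, (Fintype.card {a // hubLabel L n a = i}).factorial :=
    Finset.prod_le_prod_of_subset_of_one_le' (Finset.subset_univ T)
      fun i _ _ => Nat.factorial_pos _
  refine (h1.trans (h2.trans h3)).trans (hcard ▸ ?_)
  refine Set.ncard_le_ncard_of_injOn (fun τ => τ.trans (hubSwapFun_involutive hL2).toPerm)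
    (fun τ hτ => isSaturated_trans_hubSwap (by omega) hL2 hτ) (fun τ _ τ' _ h => ?_)
    (Set.toFinite _)
  ext i
  have := DFunLike.congr_fun h i
  simp only [Equiv.trans_apply, EmbeddingLike.apply_eq_iff_eq] at this
  rw [this]

/-! ### The containing class -/

/-- The permutations all of whose indecomposable patterns lie in `I`. -/
def sumClosure (I : Set Permutation) : Set Permutation :=
  {π | ∀ κ : Permutation, κ.IsIndecomposable → κ.IsContainedIn π → κ ∈ I}

theorem isPermutationClass_sumClosure (I : Set Permutation) :
    IsPermutationClass (sumClosure I) :=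
  fun _ _ hπ h κ hκ hκσ => hπ κ hκ (hκσ.trans h)

theorem isSumClosed_sumClosure (I : Set Permutation) : IsSumClosed (sumClosure I) := by
  refine ⟨?_, fun σ τ => ⟨fun h => ⟨?_, ?_⟩, fun h κ hκ hκσ => ?_⟩⟩
  · rintro κ hκ ⟨f, -⟩
    exact (f ⟨0, hκ.1⟩).elim0
  · exact isPermutationClass_sumClosure I _ _ h (Permutation.isContainedIn_directSum_left σ τ)
  · exact isPermutationClass_sumClosure I _ _ h (Permutation.isContainedIn_directSum_right σ τ)
  · rcases hκ.isContainedIn_of_directSum hκσ with h' | h'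
    · exact h.1 κ hκ h'
    · exact h.2 κ hκ h'

/-- If `B` and `C` are classes and no element of `A` is properly contained in an indecomposable
element of `B`, then removing from `B ∪ C` any elements of `A` outside `C` has on the indecomposable
elements of the resulting class only the obvious effect. -/
theorem indecomposables_sumClosure {B C A : Set Permutation} (hB : IsPermutationClass B)
    (hC : IsPermutationClass C) (hAC : ∀ a ∈ A, a ∉ C)
    (hA : ∀ a ∈ A, ∀ σ ∈ B, σ.IsIndecomposable → a.IsContainedIn σ → a = σ) :
    indecomposables (sumClosure ((B ∪ C) \ A)) = indecomposables ((B ∪ C) \ A) := by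
  ext σ
  constructor
  · rintro ⟨h, hσ⟩
    exact ⟨h σ hσ (Permutation.IsContainedIn.refl σ), hσ⟩
  · rintro ⟨⟨h, hσA⟩, hσ⟩
    refine ⟨fun κ _ hκσ => ?_, hσ⟩
    rcases h with h | h
    · refine ⟨.inl (hB κ σ h hκσ), fun hκA => hσA ?_⟩
      rwa [← hA κ hκA σ h hσ hκσ]
    · exact ⟨.inr (hC κ σ h hκσ), fun hκA => hAC κ hκA (hC κ σ h hκσ)⟩

theorem mainTheorem1 (C : Set Permutation) (hC : IsProperPermutationClass C) :
    ∃ D : Set Permutation, IsPermutationClass D ∧ C ⊆ D ∧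
      IsRationalSeries (generatingFunction D) := by
  classical
  obtain ⟨hCc, β, hβ⟩ := hC
  obtain ⟨K, hK⟩ := exists_ncard_not_isContainedIn_le β
  obtain ⟨k, n₀, hk⟩ := exists_pow_le_ncard_isSaturated K
  set B := bandClass k with hBdef
  -- for each length, as many saturated permutations outside `C` are chosen as `C` contributes
  -- indecomposables outside the band class
  have hchoose : ∀ n, ∃ A : Set (Equiv.Perm (Fin n)),
      (∀ a ∈ A, IsSaturated k ⟨n, a⟩ ∧ (⟨n, a⟩ : Permutation) ∉ C) ∧
      (n₀ ≤ n → A.ncard = (permutationsOfLength (indecomposables (C \ B)) n).ncard) := by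
    intro n
    by_cases hn : n₀ ≤ n
    · have hsat := hk n hn
      set Sat := {a : Equiv.Perm (Fin n) | IsSaturated k ⟨n, a⟩}
      have hCn : (permutationsOfLength C n).ncard ≤ K ^ n := by
        refine (Set.ncard_le_ncard (fun π hπ hβπ => ?_) (Set.toFinite _)).trans (hK n)
        exact hβ (hCc β _ hπ hβπ)
      -- the members of `C` outside the band class and the saturated ones are disjoint
      have hdisj : (permutationsOfLength (indecomposables (C \ B)) n).ncard +
          (Sat ∩ permutationsOfLength C n).ncard ≤ (permutationsOfLength C n).ncard := by
        rw [← Set.ncard_union_eq _ (Set.toFinite _) (Set.toFinite _)]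
        · refine Set.ncard_le_ncard ?_ (Set.toFinite _)
          rintro π (h | h)
          · exact h.1.1
          · exact h.2
        · rw [Set.disjoint_left]
          exact fun π h h' => h.1.2 h'.1.mem_bandClass
      have hdiff := Set.ncard_inter_add_ncard_sdiff_eq_ncard Sat (permutationsOfLength C n)
      obtain ⟨A, hA, hAcard⟩ := Set.exists_subset_card_eq
        (s := Sat \ permutationsOfLength C n)
        (n := (permutationsOfLength (indecomposables (C \ B)) n).ncard) (by omega)
      exact ⟨A, fun a ha => hA ha, fun _ => hAcard⟩
    · exact ⟨∅, fun a ha => ha.elim, fun h => absurd h hn⟩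
  choose A hA hAcard using hchoose
  let A' : Set Permutation := {π | π.2 ∈ A π.1}
  have hind : indecomposables (sumClosure ((B ∪ C) \ A')) = indecomposables ((B ∪ C) \ A') :=
    indecomposables_sumClosure (isPermutationClass_bandClass k) hCc (fun a ha => (hA _ _ ha).2)
      fun a ha σ hσB hσ h => (hA _ _ ha).1.eq_of_isContainedIn hσ hσB h
  refine ⟨sumClosure ((B ∪ C) \ A'), isPermutationClass_sumClosure _, fun π hπ κ _ hκ => ?_, ?_⟩
  · have hκC : κ ∈ C := hCc κ π hπ hκ
    exact ⟨.inr hκC, fun hκA => (hA _ _ hκA).2 hκC⟩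
  · refine isRationalSeries_of_eventually_eq (isSumClosed_bandClass k) (isSumClosed_sumClosure _)
      (isRationalSeries_bandPermutations k) n₀ fun n hn => ?_
    rw [hind]
    have hAB : A n ⊆ permutationsOfLength (indecomposables B) n := fun a ha =>
      ⟨(hA n a ha).1.mem_bandClass, (hA n a ha).1.isIndecomposable⟩
    have hsplit : permutationsOfLength (indecomposables ((B ∪ C) \ A')) n =
        (permutationsOfLength (indecomposables B) n \ A n) ∪
          permutationsOfLength (indecomposables (C \ B)) n := by
      ext π
      constructor
      · rintro ⟨⟨h, hπA⟩, hπ⟩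
        by_cases hπB : (⟨n, π⟩ : Permutation) ∈ B
        · exact .inl ⟨⟨hπB, hπ⟩, hπA⟩
        · exact .inr ⟨⟨h.resolve_left hπB, hπB⟩, hπ⟩
      · rintro (⟨h, hπA⟩ | h)
        · exact ⟨⟨.inl h.1, hπA⟩, h.2⟩
        · exact ⟨⟨.inr h.1.1, fun hπA => h.1.2 (hAB hπA).1⟩, h.2⟩
    rw [hsplit, Set.ncard_union_eq _ (Set.toFinite _) (Set.toFinite _), ← hAcard n hn]
    · exact Set.ncard_sdiff_add_ncard_of_subset hAB (Set.toFinite _)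
    · rw [Set.disjoint_left]
      exact fun π h h' => h'.1.2 h.1.1
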